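/- Let $\mathcal S$ be any model of abstract Stone duality (ASD): a category with finite products and an object $\Sigma$ all of whose exponentials $\Sigma^X$ exist, such that * $\Sigma$ is an internal distributive lattice satisfying the Phoa principle $F\sigma = F\bot\lor(\sigma\land F\top)$ for $F:\Sigma^\Sigma$, $\sigma:\Sigma$; * every object is sober: every (generalised) element $P$ of $\Sigma^{\Sigma^X}$ that is prime, i.e. satisfies $\mathcal F P = P(\lambda x.\mathcal F(\lambda\phi.\phi x))$ for all $\mathcal F:\Sigma^{\Sigma^{\Sigma^X}}$, is $\lambda\phi.\phi a$ for a unique $a:X$; * every nucleus splits: if $E:\Sigma^Y\to\Sigma^Y$ satisfies $E(\lambda y.\mathcal F(\lambda\phi.\phi y)) = E(\lambda y.\mathcal F(\lambda\phi.E\phi y))$ for all $\mathcal F:\Sigma^{\Sigma^{\Sigma^Y}}$, then there are $i:X\to Y$ and $I:\Sigma^X\to\Sigma^Y$ with $\Sigma^i\cdot I=\mathrm{id}$ and $I\cdot\Sigma^i=E$; * there is a natural numbers object $\mathbb N$ (with parametric primitive recursion at all types), which is overt ($\Sigma^{!}:\Sigma\to\Sigma^{\mathbb N}$ has a left adjoint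 $\exists$); * the Scott principle holds: $\Phi\xi = \exists \ell:\mathrm{Fin}(N).\,\Phi(\lambda n.n\in\ell)\land\forall n\in\ell.\,\xi n$ for every overt discrete object $N$, $\Phi:\Sigma^{\Sigma^N}$ and $\xi:\Sigma^N$, where $\mathrm{Fin}(N)$ is the object of lists on $N$, whenever that exists and is overt. (An object $N$ is discrete if it has an open equality predicate $N\times N\to\Sigma$.) The *definable* objects are those obtained from $\mathbf 1$ and $\mathbb N$ by binary products, exponentials $\Sigma^X$ and $\Sigma$-split subobjects, where $i:X\to Y$ is a *$\Sigma$-split subobject* if it is an equaliser and there is $I:\Sigma^X\to\Sigma^Y$ with $\Sigma^i\cdot I=\mathrm{id}$. An *effective basis* for $X$ indexed by an overt discrete object $N$ is a pair of families $\beta^n:\Sigma^X$, $A_n:\Sigma^{\Sigma^X}$ ($n:N$) with $\phi=\exists n.\,A_n\phi\land\beta^n$ for all $\phi:\Sigma^X$. Call $X$ *locally compact* if it has an effective basis indexed by some definable overt discrete object. An effective basis is * an *$\land$-basis* if there are $1:N$ and $\star:N\times N\to N$ with $\beta^1=\top$, $\beta^{n\star m}=\beta^n\land\beta^m$, $A_n\le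 A_{n\star m}$ and $A_m\le A_{n\star m}$; * a *$\lor$-basis* if there are $0:N$ and $+:N\times N\to N$ with $\beta^0=\bot$, $A_0=\top$, $\beta^{n+m}=\beta^n\lor\beta^m$ and $A_{n+m}=A_n\land A_m$; * a *lattice basis* if it is both; * a *filter basis* if each $A_n$ preserves $\top$ and $\land$; * a *prime basis* if there are points $p^n:X$ ($n:N$) with $A_n\phi=\phi p^n$. **Theorem.** Lists $\mathrm{Fin}(\mathbb N)$ and $\mathrm{Fin}(\mathrm{Fin}\,\mathbb N)$ exist, and every definable object $X$, more generally every locally compact object $X$, satisfies the following. 1. $X$ has a lattice basis indexed by $\mathrm{Fin}(\mathrm{Fin}\,\mathbb N)$. 2. $X$ is a $\Sigma$-split subobject of $\Sigma^{\mathbb N}$. 3. $\Sigma^X$ has a prime $\land$-basis indexed by $\mathrm{Fin}(\mathrm{Fin}\,\mathbb N)$, whose basic opens are also closed under finite joins: there are $0$ and $+$ on the index with $\beta^0=\bot$, $\beta^{n+m}=\beta^n\lor\beta^m$, $A_{n+m}\le A_n$ and $A_{n+m}\le A_m$. 4. $\Sigma^X$ is stably locally compact: it has a filter lattice basis, indexed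 by $\mathrm{Fin}(\mathrm{Fin}\,\mathbb N)$. -/

import Mathlib

open CategoryTheory MonoidalCategory CartesianMonoidalCategory

universe v u

namespace ASD

/-- A category with finite products, an object `sig` (the Sierpinski object `Σ`), all of the
exponentials `pow X = Σ^X`, and constants and binary operations on `Σ`.
The lattice laws and the other axioms are in `Model` below. -/
class SigmaData (C : Type u) [Category.{v} C] [CartesianMonoidalCategory C] where
  sig : C
  pow : C → C
  ev : ∀ X : C, pow X ⊗ X ⟶ sig
  lam : ∀ {Γ X : C}, (Γ ⊗ X ⟶ sig) → (Γ ⟶ pow X)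
  lam_beta : ∀ {Γ X : C} (f : Γ ⊗ X ⟶ sig), (lam f ▷ X) ≫ ev X = f
  lam_eta : ∀ {Γ X : C} (F : Γ ⟶ pow X), lam ((F ▷ X) ≫ ev X) = F
  top : 𝟙_ C ⟶ sig
  bot : 𝟙_ C ⟶ sig
  meet : sig ⊗ sig ⟶ sig
  join : sig ⊗ sig ⟶ sig

section Language

/-! A term `Γ ⊢ a : X` is a morphism `Γ ⟶ X`; in the context `Γ, x : X`, that is, on `Γ ⊗ X`,
the last variable is `snd Γ X` and weakening from `Γ` is composition with `fst Γ X`. -/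

variable {C : Type u} [Category.{v} C] [CartesianMonoidalCategory C] [SigmaData C]

/-- The Sierpinski object `Σ`. -/
abbrev Sig (C : Type u) [Category.{v} C] [CartesianMonoidalCategory C] [SigmaData C] : C :=
  SigmaData.sig

/-- The exponential `Σ^X`. -/
abbrev Pow (X : C) : C := SigmaData.pow X

/-- `λ`-abstraction. -/
abbrev lam {Γ X : C} (f : Γ ⊗ X ⟶ Sig C) : Γ ⟶ Pow X := SigmaData.lam f

/-- Application `F x`. -/
def app {Γ X : C} (F : Γ ⟶ Pow X) (x : Γ ⟶ X) : Γ ⟶ Sig C := lift F x ≫ SigmaData.ev X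

/-- The proposition `⊤` in context `Γ`. -/
def tt (Γ : C) : Γ ⟶ Sig C := toUnit Γ ≫ SigmaData.top

/-- The proposition `⊥` in context `Γ`. -/
def ff (Γ : C) : Γ ⟶ Sig C := toUnit Γ ≫ SigmaData.bot

/-- `σ ∧ τ`. -/
def conj {Γ : C} (σ τ : Γ ⟶ Sig C) : Γ ⟶ Sig C := lift σ τ ≫ SigmaData.meet

/-- `σ ∨ τ`. -/
def disj {Γ : C} (σ τ : Γ ⟶ Sig C) : Γ ⟶ Sig C := lift σ τ ≫ SigmaData.join

/-- The intrinsic order `σ ⇒ τ` on propositions. -/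
def Imp {Γ : C} (σ τ : Γ ⟶ Sig C) : Prop := conj σ τ = σ

/-- `Σ^f : Σ^Y → Σ^X`, taking `φ` to `λ x. φ (f x)`. -/
def powMap {X Y : C} (f : X ⟶ Y) : Pow Y ⟶ Pow X :=
  lam (app (fst (Pow Y) X) (snd (Pow Y) X ≫ f))

/-- `η : X → Σ^(Σ^X)`, taking `x` to `λ φ. φ x`. -/
def unit (X : C) : X ⟶ Pow (Pow X) := lam (app (snd X (Pow X)) (fst X (Pow X)))

/-- `Γ ⊢ P : Σ^(Σ^X)` is prime if `𝓕 P = P (λ x. 𝓕 (λ φ. φ x))` for `𝓕` of type `Σ^Σ^Σ^X`. -/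
def IsPrime {Γ X : C} (P : Γ ⟶ Pow (Pow X)) : Prop :=
  ∀ (Δ : C) (u : Δ ⟶ Γ) (F : Δ ⟶ Pow (Pow (Pow X))),
    app F (u ≫ P) = app (u ≫ P) (lam (app (fst Δ X ≫ F) (snd Δ X ≫ unit X)))

/-- `E : Σ^X → Σ^X` is a nucleus if `E (λ x. 𝓕 (λ φ. φ x)) = E (λ x. 𝓕 (λ φ. E φ x))`
for `𝓕` of type `Σ^Σ^Σ^X`. -/
def IsNucleus {X : C} (E : Pow X ⟶ Pow X) : Prop :=
  ∀ (Γ : C) (F : Γ ⟶ Pow (Pow (Pow X))),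
    lam (app (fst Γ X ≫ F) (snd Γ X ≫ unit X)) ≫ E =
      lam (app (fst Γ X ≫ F) (snd Γ X ≫ unit X ≫ powMap E)) ≫ E

/-- A discrete object: one with an open equality predicate. -/
structure Discrete (N : C) where
  eq : N ⊗ N ⟶ Sig C
  eq_iff : ∀ {Γ : C} (n m : Γ ⟶ N), lift n m ≫ eq = tt Γ ↔ n = m

/-- An overt object: `Σ^! : Σ → Σ^N` has a left adjoint, the existential quantifier. -/
structure Overt (N : C) where
  ex : Pow N ⟶ Sig C
  adj : ∀ {Γ : C} (φ : Γ ⊗ N ⟶ Sig C) (σ : Γ ⟶ Sig C),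
    Imp (lam φ ≫ ex) σ ↔ Imp φ (fst Γ N ≫ σ)

/-- `Γ ⊢ ∃ n : N. φ n`. -/
def Overt.exists {N : C} (o : Overt N) {Γ : C} (φ : Γ ⊗ N ⟶ Sig C) : Γ ⟶ Sig C :=
  lam φ ≫ o.ex

/-- A natural numbers object: it admits (parametric) primitive recursion at all types,
`h (γ, 0) = f γ` and `h (γ, n + 1) = g (γ, n, h (γ, n))`. -/
structure NatObj (N : C) where
  zero : 𝟙_ C ⟶ N
  succ : N ⟶ N
  recur : ∀ {Γ X : C}, (Γ ⟶ X) → ((Γ ⊗ N) ⊗ X ⟶ X) → (Γ ⊗ N ⟶ X)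
  recur_zero : ∀ {Γ X : C} (f : Γ ⟶ X) (g : (Γ ⊗ N) ⊗ X ⟶ X),
    lift (𝟙 Γ) (toUnit Γ ≫ zero) ≫ recur f g = f
  recur_succ : ∀ {Γ X : C} (f : Γ ⟶ X) (g : (Γ ⊗ N) ⊗ X ⟶ X),
    (Γ ◁ succ) ≫ recur f g = lift (𝟙 (Γ ⊗ N)) (recur f g) ≫ g
  recur_unique : ∀ {Γ X : C} (f : Γ ⟶ X) (g : (Γ ⊗ N) ⊗ X ⟶ X) (h : Γ ⊗ N ⟶ X),
    lift (𝟙 Γ) (toUnit Γ ≫ zero) ≫ h = f →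
    (Γ ◁ succ) ≫ h = lift (𝟙 (Γ ⊗ N)) h ≫ g → h = recur f g

/-- `L` is the object of lists (the free monoid) on `N`: it admits (parametric) primitive
recursion at all types, `h (γ, []) = f γ` and `h (γ, n :: l) = g (γ, n, l, h (γ, l))`. -/
structure ListObj (N L : C) where
  nil : 𝟙_ C ⟶ L
  cons : N ⊗ L ⟶ L
  recur : ∀ {Γ X : C}, (Γ ⟶ X) → ((Γ ⊗ (N ⊗ L)) ⊗ X ⟶ X) → (Γ ⊗ L ⟶ X)
  recur_nil : ∀ {Γ X : C} (f : Γ ⟶ X) (g : (Γ ⊗ (N ⊗ L)) ⊗ X ⟶ X),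
    lift (𝟙 Γ) (toUnit Γ ≫ nil) ≫ recur f g = f
  recur_cons : ∀ {Γ X : C} (f : Γ ⟶ X) (g : (Γ ⊗ (N ⊗ L)) ⊗ X ⟶ X),
    (Γ ◁ cons) ≫ recur f g =
      lift (𝟙 (Γ ⊗ (N ⊗ L))) ((Γ ◁ snd N L) ≫ recur f g) ≫ g
  recur_unique : ∀ {Γ X : C} (f : Γ ⟶ X) (g : (Γ ⊗ (N ⊗ L)) ⊗ X ⟶ X) (h : Γ ⊗ L ⟶ X),
    lift (𝟙 Γ) (toUnit Γ ≫ nil) ≫ h = f →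
    (Γ ◁ cons) ≫ h = lift (𝟙 (Γ ⊗ (N ⊗ L))) ((Γ ◁ snd N L) ≫ h) ≫ g → h = recur f g

/-- Membership `m ∈ l` of a list, for `m : N` and `l : L`, on `N ⊗ L`:
`m ∈ []` is `⊥`, and `m ∈ n :: l` is `(n = m) ∨ (m ∈ l)`. -/
def ListObj.mem {N L : C} (l : ListObj N L) (d : Discrete N) : N ⊗ L ⟶ Sig C :=
  l.recur (ff N)
    (disj
      (lift (fst (N ⊗ (N ⊗ L)) (Sig C) ≫ snd N (N ⊗ L) ≫ fst N L)
        (fst (N ⊗ (N ⊗ L)) (Sig C) ≫ fst N (N ⊗ L)) ≫ d.eq)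
      (snd (N ⊗ (N ⊗ L)) (Sig C)))

/-- `l ↦ λ m. m ∈ l`. -/
def ListObj.toPow {N L : C} (l : ListObj N L) (d : Discrete N) : L ⟶ Pow N :=
  lam (lift (snd L N) (fst L N) ≫ l.mem d)

/-- `∀ m ∈ l. ξ m`, for `ξ : Σ^N` and `l : L`, on `Σ^N ⊗ L`:
it is `⊤` at `[]`, and `ξ n ∧ ∀ m ∈ l. ξ m` at `n :: l`. -/
def ListObj.all {N L : C} (l : ListObj N L) : Pow N ⊗ L ⟶ Sig C :=
  l.recur (tt (Pow N))
    (conj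
      (app (fst (Pow N ⊗ (N ⊗ L)) (Sig C) ≫ fst (Pow N) (N ⊗ L))
        (fst (Pow N ⊗ (N ⊗ L)) (Sig C) ≫ snd (Pow N) (N ⊗ L) ≫ fst N L))
      (snd (Pow N ⊗ (N ⊗ L)) (Sig C)))

/-- `i : X → Y` is the inclusion of a `Σ`-split subobject: it is an equaliser, and there is
`I : Σ^X → Σ^Y` with `Σ^i ∘ I = id`. -/
def IsSigmaSplit {X Y : C} (i : X ⟶ Y) : Prop :=
  IsRegularMono i ∧ ∃ I : Pow X ⟶ Pow Y, I ≫ powMap i = 𝟙 (Pow X)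

/-- `X` is a `Σ`-split subobject of `Y`. -/
def SigmaSplitSubobject (X Y : C) : Prop := ∃ i : X ⟶ Y, IsSigmaSplit i

/-- An effective basis for `X` indexed by an overt discrete object `N`: families `β^n : Σ^X` and
`A_n : Σ^(Σ^X)` such that `φ x = ∃ n. A_n φ ∧ β^n x`. -/
structure EffectiveBasis (N X : C) where
  overt : Overt N
  discrete : Discrete N
  β : N ⟶ Pow X
  A : N ⟶ Pow (Pow X)
  expansion : ∀ {Γ : C} (φ : Γ ⟶ Pow X) (x : Γ ⟶ X),
    app φ x = overt.exists
      (conj (app (snd Γ N ≫ A) (fst Γ N ≫ φ)) (app (snd Γ N ≫ β) (fst Γ N ≫ x)))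

namespace EffectiveBasis

variable {N X : C} (b : EffectiveBasis N X)

/-- A directed basis, or `∨`-basis: `β^0 = ⊥`, `A_0 = ⊤`, `β^(n+m) = β^n ∨ β^m` and
`A_(n+m) = A_n ∧ A_m`. -/
def IsJoinBasis : Prop :=
  ∃ (zero : 𝟙_ C ⟶ N) (plus : N ⊗ N ⟶ N),
    (∀ {Γ : C} (x : Γ ⟶ X), app (toUnit Γ ≫ zero ≫ b.β) x = ff Γ) ∧
    (∀ {Γ : C} (φ : Γ ⟶ Pow X), app (toUnit Γ ≫ zero ≫ b.A) φ = tt Γ) ∧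
    (∀ {Γ : C} (n m : Γ ⟶ N) (x : Γ ⟶ X),
      app (lift n m ≫ plus ≫ b.β) x = disj (app (n ≫ b.β) x) (app (m ≫ b.β) x)) ∧
    (∀ {Γ : C} (n m : Γ ⟶ N) (φ : Γ ⟶ Pow X),
      app (lift n m ≫ plus ≫ b.A) φ = conj (app (n ≫ b.A) φ) (app (m ≫ b.A) φ))

/-- An intersection basis, or `∧`-basis: `β^1 = ⊤`, `β^(n⋆m) = β^n ∧ β^m`,
`A_n ≤ A_(n⋆m)` and `A_m ≤ A_(n⋆m)`. -/
def IsMeetBasis : Prop :=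
  ∃ (one : 𝟙_ C ⟶ N) (star : N ⊗ N ⟶ N),
    (∀ {Γ : C} (x : Γ ⟶ X), app (toUnit Γ ≫ one ≫ b.β) x = tt Γ) ∧
    (∀ {Γ : C} (n m : Γ ⟶ N) (x : Γ ⟶ X),
      app (lift n m ≫ star ≫ b.β) x = conj (app (n ≫ b.β) x) (app (m ≫ b.β) x)) ∧
    (∀ {Γ : C} (n m : Γ ⟶ N) (φ : Γ ⟶ Pow X),
      Imp (app (n ≫ b.A) φ) (app (lift n m ≫ star ≫ b.A) φ) ∧
      Imp (app (m ≫ b.A) φ) (app (lift n m ≫ star ≫ b.A) φ))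

/-- A lattice basis: both an `∧`-basis and a `∨`-basis. -/
def IsLatticeBasis : Prop := b.IsMeetBasis ∧ b.IsJoinBasis

/-- A filter basis: each `A_n` preserves `⊤` and `∧`. -/
def IsFilterBasis : Prop :=
  (∀ {Γ : C} (n : Γ ⟶ N), app (n ≫ b.A) (lam (tt (Γ ⊗ X))) = tt Γ) ∧
  (∀ {Γ : C} (n : Γ ⟶ N) (φ ψ : Γ ⊗ X ⟶ Sig C),
    app (n ≫ b.A) (lam (conj φ ψ)) =
      conj (app (n ≫ b.A) (lam φ)) (app (n ≫ b.A) (lam ψ)))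

/-- A prime basis: there are points `p^n : X` with `A_n φ = φ p^n`. -/
def IsPrimeBasis : Prop :=
  ∃ p : N ⟶ X, ∀ {Γ : C} (n : Γ ⟶ N) (φ : Γ ⟶ Pow X),
    app (n ≫ b.A) φ = app φ (n ≫ p)

/-- The basic open subobjects are closed under finite joins: `β^0 = ⊥` and
`β^(n+m) = β^n ∨ β^m`, with `A_(n+m) ≤ A_n` and `A_(n+m) ≤ A_m`. In comparison with a `∨`-basis,
neither `A_0 = ⊤` nor `A_n ∧ A_m ≤ A_(n+m)` is required (a prime basis cannot satisfy the
former, since `A_0 ⊥ = ⊥` for it). -/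
def IsJoinClosed : Prop :=
  ∃ (zero : 𝟙_ C ⟶ N) (plus : N ⊗ N ⟶ N),
    (∀ {Γ : C} (x : Γ ⟶ X), app (toUnit Γ ≫ zero ≫ b.β) x = ff Γ) ∧
    (∀ {Γ : C} (n m : Γ ⟶ N) (x : Γ ⟶ X),
      app (lift n m ≫ plus ≫ b.β) x = disj (app (n ≫ b.β) x) (app (m ≫ b.β) x)) ∧
    (∀ {Γ : C} (n m : Γ ⟶ N) (φ : Γ ⟶ Pow X),
      Imp (app (lift n m ≫ plus ≫ b.A) φ) (app (n ≫ b.A) φ) ∧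
      Imp (app (lift n m ≫ plus ≫ b.A) φ) (app (m ≫ b.A) φ))

end EffectiveBasis

end Language

/-- A model of abstract Stone duality. -/
class Model (C : Type u) [Category.{v} C] [CartesianMonoidalCategory C]
    extends SigmaData C where
  -- `Σ` is an internal distributive lattice
  conj_comm : ∀ {Γ : C} (ρ σ : Γ ⟶ Sig C), conj ρ σ = conj σ ρ
  disj_comm : ∀ {Γ : C} (ρ σ : Γ ⟶ Sig C), disj ρ σ = disj σ ρ
  conj_assoc : ∀ {Γ : C} (ρ σ τ : Γ ⟶ Sig C), conj (conj ρ σ) τ = conj ρ (conj σ τ)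
  disj_assoc : ∀ {Γ : C} (ρ σ τ : Γ ⟶ Sig C), disj (disj ρ σ) τ = disj ρ (disj σ τ)
  conj_disj_self : ∀ {Γ : C} (ρ σ : Γ ⟶ Sig C), conj ρ (disj ρ σ) = ρ
  disj_conj_self : ∀ {Γ : C} (ρ σ : Γ ⟶ Sig C), disj ρ (conj ρ σ) = ρ
  conj_top : ∀ {Γ : C} (ρ : Γ ⟶ Sig C), conj ρ (tt Γ) = ρ
  disj_bot : ∀ {Γ : C} (ρ : Γ ⟶ Sig C), disj ρ (ff Γ) = ρ
  conj_disj : ∀ {Γ : C} (ρ σ τ : Γ ⟶ Sig C),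
    conj ρ (disj σ τ) = disj (conj ρ σ) (conj ρ τ)
  /-- The Phoa principle: `F σ = F ⊥ ∨ (σ ∧ F ⊤)`. -/
  phoa : ∀ {Γ : C} (F : Γ ⟶ Pow (Sig C)) (σ : Γ ⟶ Sig C),
    app F σ = disj (app F (ff Γ)) (conj σ (app F (tt Γ)))
  /-- Every object is sober: a prime `P` is `λ φ. φ a` for a unique `a` (called `focus P`). -/
  sober : ∀ {Γ X : C} (P : Γ ⟶ Pow (Pow X)), IsPrime P → ∃! a : Γ ⟶ X, a ≫ unit X = P
  /-- Every nucleus `E` on `Σ^Y` is split by a subobject `i : {Y | E} → Y`, with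
  `Σ^i ∘ I = id` and `I ∘ Σ^i = E` (by sobriety, `i` is then an equaliser). Together with
  sobriety, this is the symbolic form of the monadicity of the self-adjunction of `Σ^(-)`. -/
  nucleus_split : ∀ {Y : C} (E : Pow Y ⟶ Pow Y), IsNucleus E →
    ∃ (X : C) (i : X ⟶ Y) (I : Pow X ⟶ Pow Y),
      I ≫ powMap i = 𝟙 (Pow X) ∧ powMap i ≫ I = E
  /-- The natural numbers object, which is overt. -/
  nat : C
  natObj : NatObj nat
  natOvert : Overt nat
  /-- The Scott principle: `Φ ξ = ∃ l. Φ (λ n. n ∈ l) ∧ ∀ n ∈ l. ξ n`, where `l` ranges over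
  lists of elements of the overt discrete object `N`. -/
  scott : ∀ {N L : C} (_ : Overt N) (d : Discrete N) (l : ListObj N L) (o : Overt L)
    {Γ : C} (Φ : Γ ⟶ Pow (Pow N)) (ξ : Γ ⟶ Pow N),
    app Φ ξ = o.exists
      (conj (app (fst Γ L ≫ Φ) (snd Γ L ≫ l.toPow d)) (lift (fst Γ L ≫ ξ) (snd Γ L) ≫ l.all))

section Definable

variable {C : Type u} [Category.{v} C] [CartesianMonoidalCategory C] [Model C]

/-- The natural numbers object of the model. -/
abbrev Nats (C : Type u) [Category.{v} C] [CartesianMonoidalCategory C] [Model C] : C :=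
  Model.nat

/-- The definable objects: those obtained from `1` and `ℕ` by means of binary products, the
exponential `Σ^X` and `Σ`-split subobjects. -/
inductive Definable : C → Prop
  | one : Definable (𝟙_ C)
  | nat : Definable (Nats C)
  | prod {X Y : C} : Definable X → Definable Y → Definable (X ⊗ Y)
  | pow {X : C} : Definable X → Definable (Pow X)
  | split {X Y : C} (i : X ⟶ Y) : IsSigmaSplit i → Definable Y → Definable X

/-- An object is locally compact (relative to the definable index objects) if it has an effective
basis that is indexed by some definable overt discrete object. -/
def LocallyCompact (X : C) : Prop :=
  ∃ N : C, Definable N ∧ Nonempty (EffectiveBasis N X)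

end Definable

end ASD

/-!
Everything is reduced to one fact: every definable or locally compact object `X` is a `Σ`-split
subobject of `Σ^ℕ`. All four bases are then computed from the Scott principle for `ℕ`.

*Lists.* Both `Fin ℕ` and `Fin (Fin ℕ)` are taken to be `ℕ`. Cantor's pairing function gives an
isomorphism `ℕ × ℕ ≅ ℕ` (`NatObj.unpair_pair`, `NatObj.pair_unpair`), so lists can be coded by
`[] = 0` and `n :: l = pair (l, n) + 1`. Recursion over lists with values in an arbitrary object is
obtained from recursion over `ℕ` in which parameters may change (`NatObj.exists_param`,
`NatObj.param_ext`). For values in a power of `Σ`, this is ordinary recursion for functions of the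
parameters; for an arbitrary `X`, the predicate `φ (h (γ, n))` of `φ : Σ^X` is defined in that way,
it is prime by induction, and sobriety yields `h`. The same principle gives the open equality
predicate of `ℕ` (`NatObj.discrete`).

*Subobjects.* By sobriety, any `i : X → Y` for which `Σ^i` is split is an equaliser
(`isSigmaSplit_of_section`). A basis indexed by `N` makes `X` a `Σ`-split subobject of `Σ^N`, and
if `X` is one of `Y` then `Σ^X` is a retract of `Σ^Y`. The Scott principle makes `Σ^(Σ^ℕ)` a
retract of `Σ^ℕ`. Hence the `Σ`-split subobjects of `Σ^ℕ` are closed under products and powers, so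
they include the definable objects (`Definable.sigmaSplit`), and also every object with a basis
indexed by one of them (`LocallyCompact.sigmaSplit`).

*Bases.* The Scott principle is a prime `∧`-basis for `Σ^ℕ`, and it restricts to an `∧`-basis for
any `Σ`-split subobject. Closing a basis under finite joins, with `∃ n ∈ t. β^n` and
`∀ n ∈ t. A_n` for a list `t` of indices, turns an `∧`-basis into a lattice basis and a prime basis
into a filter basis (`IsMeetBasis.joinClosure`, `IsPrimeBasis.joinClosure`). For `Σ^X`, the basis
of `X` is first closed under joins of the `A_n`, and `Σ^X` is then a retract of `Σ^ℕ` by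
`φ ↦ λ n. A_n φ`, along which the Scott basis restricts to a prime `∧`-basis whose open sets are
closed under joins (`exists_prime_basis_pow`).

Identities are checked on generalised elements. Composites are associated to the left there, so
that they read as functions applied to elements.
-/

/-! ### The internal language, in terms of generalised elements -/

namespace ASD

section Language

variable {C : Type u} [Category.{v} C] [CartesianMonoidalCategory C]

/-- Maps out of a product agree if they agree on all generalised elements. -/
lemma tensor_ext {Γ X Y : C} {h k : Γ ⊗ X ⟶ Y}
    (H : ∀ (Δ : C) (γ : Δ ⟶ Γ) (x : Δ ⟶ X), lift γ x ≫ h = lift γ x ≫ k) : h = k := by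
  simpa using H _ (fst Γ X) (snd Γ X)

lemma exists_eq_lift {Δ X Y : C} (p : Δ ⟶ X ⊗ Y) : ∃ a b, p = lift a b :=
  ⟨p ≫ fst X Y, p ≫ snd X Y, by simp⟩

variable [SigmaData C]

@[simp] lemma comp_app {Δ Γ X : C} (f : Δ ⟶ Γ) (F : Γ ⟶ Pow X) (x : Γ ⟶ X) :
    f ≫ app F x = app (f ≫ F) (f ≫ x) := by simp [app, ← Category.assoc]

@[simp] lemma comp_tt {Δ Γ : C} (f : Δ ⟶ Γ) : f ≫ tt Γ = tt Δ := by simp [tt]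

@[simp] lemma comp_ff {Δ Γ : C} (f : Δ ⟶ Γ) : f ≫ ff Γ = ff Δ := by simp [ff]

@[simp] lemma comp_conj {Δ Γ : C} (f : Δ ⟶ Γ) (σ τ : Γ ⟶ Sig C) :
    f ≫ conj σ τ = conj (f ≫ σ) (f ≫ τ) := by simp [conj, ← Category.assoc]

@[simp] lemma comp_disj {Δ Γ : C} (f : Δ ⟶ Γ) (σ τ : Γ ⟶ Sig C) :
    f ≫ disj σ τ = disj (f ≫ σ) (f ≫ τ) := by simp [disj, ← Category.assoc]

@[simp] lemma app_comp_lam {Δ Γ X : C} (f : Δ ⟶ Γ) (φ : Γ ⊗ X ⟶ Sig C) (x : Δ ⟶ X) :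
    app (f ≫ lam φ) x = lift f x ≫ φ := by
  conv_rhs => rw [← SigmaData.lam_beta φ, ← Category.assoc]
  simp [app]

@[simp] lemma app_lam {Γ X : C} (φ : Γ ⊗ X ⟶ Sig C) (x : Γ ⟶ X) :
    app (lam φ) x = lift (𝟙 Γ) x ≫ φ := by
  simpa using app_comp_lam (𝟙 Γ) φ x

lemma lam_app {Γ X : C} (F : Γ ⟶ Pow X) : lam (app (fst Γ X ≫ F) (snd Γ X)) = F := by
  conv_rhs => rw [← SigmaData.lam_eta F]
  congr 1
  rw [app]
  congr 1
  ext <;> simp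

/-- Extensionality for `Σ^X`. -/
lemma pow_ext {Γ X : C} {F G : Γ ⟶ Pow X}
    (H : ∀ (Δ : C) (γ : Δ ⟶ Γ) (x : Δ ⟶ X), app (γ ≫ F) x = app (γ ≫ G) x) : F = G := by
  rw [← lam_app F, ← lam_app G, H]

lemma comp_lam {Δ Γ X : C} (f : Δ ⟶ Γ) (φ : Γ ⊗ X ⟶ Sig C) :
    f ≫ lam φ = lam (lift (fst Δ X ≫ f) (snd Δ X) ≫ φ) := by
  apply pow_ext
  intro Θ γ x
  rw [← Category.assoc, app_comp_lam, app_comp_lam, ← Category.assoc]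
  simp

@[simp] lemma app_comp_powMap {Γ X Y : C} (f : X ⟶ Y) (ψ : Γ ⟶ Pow Y) (x : Γ ⟶ X) :
    app (ψ ≫ powMap f) x = app ψ (x ≫ f) := by
  simp [powMap]

@[simp] lemma app_comp_unit {Γ X : C} (x : Γ ⟶ X) (φ : Γ ⟶ Pow X) :
    app (x ≫ unit X) φ = app φ x := by
  simp [unit]

lemma Overt.comp_exists {N : C} (o : Overt N) {Δ Γ : C} (f : Δ ⟶ Γ) (φ : Γ ⊗ N ⟶ Sig C) :
    f ≫ o.exists φ = o.exists (lift (fst Δ N ≫ f) (snd Δ N) ≫ φ) := by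
  rw [Overt.exists, Overt.exists, ← comp_lam, Category.assoc]

end Language

/-! ### The lattice of propositions and the Phoa principle -/

section Lattice

variable {C : Type u} [Category.{v} C] [CartesianMonoidalCategory C] [Model C]

/-- Propositions in a context form a distributive lattice, with `conj` as meet and `disj` as
join. -/
instance propLattice (Γ : C) : DistribLattice (Γ ⟶ Sig C) :=
  letI : Max (Γ ⟶ Sig C) := ⟨disj⟩
  letI : Min (Γ ⟶ Sig C) := ⟨conj⟩
  letI L : Lattice (Γ ⟶ Sig C) := Lattice.mk' Model.disj_comm Model.disj_assoc Model.conj_comm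
    Model.conj_assoc Model.disj_conj_self Model.conj_disj_self
  { L with
    le_sup_inf := fun a b c => by
      have key : ∀ x y z : Γ ⟶ Sig C, x ⊓ (y ⊔ z) = x ⊓ y ⊔ x ⊓ z := Model.conj_disj
      rw [key, inf_comm (a ⊔ b) a, inf_comm (a ⊔ b) c, inf_sup_self, key, ← sup_assoc,
        inf_comm c a, sup_inf_self, inf_comm c b] }

lemma conj_eq {Γ : C} (σ τ : Γ ⟶ Sig C) : conj σ τ = σ ⊓ τ := rfl

lemma disj_eq {Γ : C} (σ τ : Γ ⟶ Sig C) : disj σ τ = σ ⊔ τ := rfl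

lemma imp_iff {Γ : C} (σ τ : Γ ⟶ Sig C) : Imp σ τ ↔ σ ≤ τ := by
  rw [Imp, conj_eq, inf_eq_left]

instance propBounded (Γ : C) : BoundedOrder (Γ ⟶ Sig C) where
  top := tt Γ
  bot := ff Γ
  le_top σ := inf_eq_left.1 (Model.conj_top σ)
  bot_le σ := sup_eq_left.1 (Model.disj_bot σ)

lemma tt_eq (Γ : C) : tt Γ = ⊤ := rfl

lemma ff_eq (Γ : C) : ff Γ = ⊥ := rfl

@[simp] lemma comp_inf {Δ Γ : C} (f : Δ ⟶ Γ) (σ τ : Γ ⟶ Sig C) :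
    f ≫ (σ ⊓ τ) = f ≫ σ ⊓ f ≫ τ := comp_conj f σ τ

@[simp] lemma comp_sup {Δ Γ : C} (f : Δ ⟶ Γ) (σ τ : Γ ⟶ Sig C) :
    f ≫ (σ ⊔ τ) = f ≫ σ ⊔ f ≫ τ := comp_disj f σ τ

@[simp] lemma comp_top {Δ Γ : C} (f : Δ ⟶ Γ) : f ≫ (⊤ : Γ ⟶ Sig C) = ⊤ := comp_tt f

@[simp] lemma comp_bot {Δ Γ : C} (f : Δ ⟶ Γ) : f ≫ (⊥ : Γ ⟶ Sig C) = ⊥ := comp_ff f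

lemma comp_mono {Δ Γ : C} (f : Δ ⟶ Γ) {σ τ : Γ ⟶ Sig C} (h : σ ≤ τ) : f ≫ σ ≤ f ≫ τ := by
  rw [← inf_eq_left] at h ⊢
  rw [← comp_inf, h]

/-- By the Phoa principle, every map between powers of `Σ` is monotone: to compare `F φ` and
`F ψ` with `φ ≤ ψ`, consider `σ ↦ F (φ ∨ (σ ∧ ψ))`. -/
lemma app_mono {Γ X : C} (F : Γ ⟶ Pow (Pow X)) {φ ψ : Γ ⟶ Pow X}
    (h : ∀ (Δ : C) (γ : Δ ⟶ Γ) (x : Δ ⟶ X), app (γ ≫ φ) x ≤ app (γ ≫ ψ) x) :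
    app F φ ≤ app F ψ := by
  -- `m σ = φ ∨ (σ ∧ ψ)`
  let m : Γ ⊗ Sig C ⟶ Pow X :=
    lam (app (fst _ X ≫ fst Γ _ ≫ φ) (snd _ X) ⊔
      (fst _ X ≫ snd Γ (Sig C)) ⊓ app (fst _ X ≫ fst Γ _ ≫ ψ) (snd _ X))
  have h0 : lift (𝟙 Γ) (ff Γ) ≫ m = φ := by
    apply pow_ext
    intro Δ γ x
    rw [← Category.assoc, app_comp_lam]
    simp [ff_eq]
  have h1 : lift (𝟙 Γ) (tt Γ) ≫ m = ψ := by
    apply pow_ext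
    intro Δ γ x
    rw [← Category.assoc, app_comp_lam]
    simpa [tt_eq] using h Δ γ x
  have key := Model.phoa (lam (app (fst Γ (Sig C) ≫ F) m)) (tt Γ)
  simp only [app_lam, comp_app, lift_fst_assoc, Category.id_comp, h0, h1] at key
  rw [key, disj_eq]
  exact le_sup_left

namespace Overt

variable {N : C} (o : Overt N) {Γ : C}

/-- `∃ n. φ n ≤ σ` if and only if `φ n ≤ σ` for every generalised element `n`. -/
lemma exists_le_iff (φ : Γ ⊗ N ⟶ Sig C) (σ : Γ ⟶ Sig C) :
    o.exists φ ≤ σ ↔ ∀ (Δ : C) (γ : Δ ⟶ Γ) (n : Δ ⟶ N), lift γ n ≫ φ ≤ γ ≫ σ := by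
  have h := o.adj φ σ
  rw [imp_iff, imp_iff] at h
  refine h.trans ⟨fun H Δ γ n => ?_, fun H => ?_⟩
  · simpa using comp_mono (lift γ n) H
  · simpa using H _ (fst Γ N) (snd Γ N)

lemma le_exists (φ : Γ ⊗ N ⟶ Sig C) (n : Γ ⟶ N) : lift (𝟙 Γ) n ≫ φ ≤ o.exists φ := by
  simpa using (o.exists_le_iff φ (o.exists φ)).1 le_rfl Γ (𝟙 Γ) n

end Overt

end Lattice

/-! ### Sobriety and `Σ`-split subobjects -/

section Sober

variable {C : Type u} [Category.{v} C] [CartesianMonoidalCategory C] [Model C]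

/-- Sobriety implies the `T₀` property: points are determined by the open sets containing them. -/
lemma point_ext {Γ X : C} {a b : Γ ⟶ X}
    (h : ∀ (Δ : C) (γ : Δ ⟶ Γ) (φ : Δ ⟶ Pow X), app φ (γ ≫ a) = app φ (γ ≫ b)) : a = b := by
  -- `λ φ. φ b` is prime, so it has only one focus
  have hp : IsPrime (b ≫ unit X) := by
    intro Δ u F
    rw [← Category.assoc, app_comp_unit]
    simp
  refine (Model.sober _ hp).unique ?_ rfl
  apply pow_ext
  intro Δ γ φ
  simpa [← Category.assoc] using h Δ γ φ

/-- If `Σ^i` is split by `I` then `i` is the equaliser of `η` and `y ↦ λ ψ. (I (ψ ∘ i)) y`: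
where these agree, `λ φ. (I φ) y` is prime, and its focus is the required point. -/
lemma isSigmaSplit_of_section {X Y : C} (i : X ⟶ Y) (I : Pow X ⟶ Pow Y)
    (h : I ≫ powMap i = 𝟙 (Pow X)) : IsSigmaSplit i := by
  have hI {Γ : C} (φ : Γ ⟶ Pow X) (x : Γ ⟶ X) : app (φ ≫ I) (x ≫ i) = app φ x := by
    rw [← app_comp_powMap, Category.assoc, h, Category.comp_id]
  -- `e y = λ ψ. (I (ψ ∘ i)) y`
  let e : Y ⟶ Pow (Pow Y) := lam (app (snd Y (Pow Y) ≫ powMap i ≫ I) (fst Y (Pow Y)))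
  have w : i ≫ unit Y = i ≫ e := by
    apply pow_ext
    intro Δ γ ψ
    have := hI (ψ ≫ powMap i) γ
    simp only [Category.assoc, app_comp_powMap] at this
    simp [← Category.assoc, e]
    simpa using this.symm
  -- every generalised element `y` of the equaliser factors through `i`
  have key {Γ : C} (y : Γ ⟶ Y) (hy : y ≫ unit Y = y ≫ e) : ∃ a : Γ ⟶ X, a ≫ i = y := by
    have hy' {Δ : C} (γ : Δ ⟶ Γ) (ψ : Δ ⟶ Pow Y) :
        app ψ (γ ≫ y) = app (ψ ≫ powMap i ≫ I) (γ ≫ y) := by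
      have := congrArg (fun t => app (γ ≫ t) ψ) hy
      simpa [e, ← Category.assoc] using this
    have hp : IsPrime (lam (app (snd Γ (Pow X) ≫ I) (fst Γ (Pow X) ≫ y))) := by
      intro Δ γ F
      -- `ψ = λ y. F (λ φ. (I φ) y)`
      let ψ : Δ ⟶ Pow Y := lam (app (fst Δ Y ≫ F)
        (lam (app (snd (Δ ⊗ Y) (Pow X) ≫ I) (fst (Δ ⊗ Y) (Pow X) ≫ snd Δ Y))))
      have h1 := hy' γ ψ
      have h2 : ψ ≫ powMap i = lam (app (fst Δ X ≫ F) (snd Δ X ≫ unit X)) := by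
        apply pow_ext
        intro Θ θ x
        simp only [← Category.assoc, app_comp_powMap]
        simp only [ψ, app_comp_lam, comp_app, lift_fst_assoc, lift_snd_assoc]
        congr 1
        apply pow_ext
        intro Ξ ξ φ
        simp only [← Category.assoc, app_comp_lam, app_comp_unit]
        simp [hI, ← Category.assoc]
      rw [← Category.assoc, h2] at h1
      simp only [app_comp_lam, comp_app, lift_fst_assoc, lift_snd_assoc]
      rw [← h1]
      simp only [ψ, app_lam, comp_app, lift_fst_assoc, Category.id_comp]
      congr 1
      apply pow_ext
      intro Ξ ξ φ
      simp [← Category.assoc]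
    obtain ⟨a, ha, -⟩ := Model.sober _ hp
    refine ⟨a, point_ext fun Δ γ ψ => ?_⟩
    have h3 := congrArg (fun t => app (γ ≫ t) (ψ ≫ powMap i)) ha
    simp only [← Category.assoc, app_comp_unit, app_comp_lam] at h3
    rw [hy' γ ψ]
    simpa using h3
  have hmono {Γ : C} (a b : Γ ⟶ X) (hab : a ≫ i = b ≫ i) : a = b := by
    refine point_ext fun Δ γ φ => ?_
    rw [← hI φ, ← hI φ, Category.assoc, hab, Category.assoc]
  refine ⟨⟨⟨?_⟩⟩, I, h⟩
  exact
    { Z := Pow (Pow Y)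
      left := unit Y
      right := e
      w := w
      isLimit := Limits.Fork.IsLimit.mk' _ fun s =>
        ⟨(key s.ι s.condition).choose, (key s.ι s.condition).choose_spec, fun {m} hm =>
          hmono _ _ (hm.trans (key s.ι s.condition).choose_spec.symm)⟩ }

end Sober

end ASD

/-! ### Recursion over the natural numbers, with changing parameters -/

namespace ASD

section Recursion

variable {C : Type u} [Category.{v} C] [CartesianMonoidalCategory C]

namespace NatObj

variable {N : C} (R : NatObj N) {Γ Δ X : C}

/-- Zero in an arbitrary context. -/
abbrev zeroAt (Γ : C) : Γ ⟶ N := toUnit Γ ≫ R.zero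

lemma lift_zero_recur (f : Γ ⟶ X) (g : (Γ ⊗ N) ⊗ X ⟶ X) (γ : Δ ⟶ Γ) :
    lift γ (R.zeroAt Δ) ≫ R.recur f g = γ ≫ f := by
  conv_rhs => rw [← R.recur_zero f g, ← Category.assoc]
  simp

lemma lift_succ_recur (f : Γ ⟶ X) (g : (Γ ⊗ N) ⊗ X ⟶ X) (γ : Δ ⟶ Γ) (n : Δ ⟶ N) :
    lift γ (n ≫ R.succ) ≫ R.recur f g = lift (lift γ n) (lift γ n ≫ R.recur f g) ≫ g := by
  have := congrArg (fun t => lift γ n ≫ t) (R.recur_succ f g)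
  simpa [← Category.assoc] using this

/-- Functions that obey the same primitive recursion are equal. -/
lemma funext {h k : Γ ⊗ N ⟶ X} (g : (Γ ⊗ N) ⊗ X ⟶ X)
    (h0 : ∀ (Δ : C) (γ : Δ ⟶ Γ), lift γ (R.zeroAt Δ) ≫ h = lift γ (R.zeroAt Δ) ≫ k)
    (hh : ∀ (Δ : C) (γ : Δ ⟶ Γ) (n : Δ ⟶ N),
      lift γ (n ≫ R.succ) ≫ h = lift (lift γ n) (lift γ n ≫ h) ≫ g)
    (hk : ∀ (Δ : C) (γ : Δ ⟶ Γ) (n : Δ ⟶ N),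
      lift γ (n ≫ R.succ) ≫ k = lift (lift γ n) (lift γ n ≫ k) ≫ g) : h = k := by
  have e : Γ ◁ R.succ = lift (fst Γ N) (snd Γ N ≫ R.succ) := by ext <;> simp
  rw [R.recur_unique _ g h rfl (by rw [e, hh]; simp),
    R.recur_unique _ g k (h0 Γ (𝟙 Γ)).symm (by rw [e, hk]; simp)]

/-- Case distinction: a function on `N` is determined by its values at zero and at successors. -/
lemma cases_ext {h k : Γ ⊗ N ⟶ X}
    (h0 : ∀ (Δ : C) (γ : Δ ⟶ Γ), lift γ (R.zeroAt Δ) ≫ h = lift γ (R.zeroAt Δ) ≫ k)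
    (hs : ∀ (Δ : C) (γ : Δ ⟶ Γ) (n : Δ ⟶ N),
      lift γ (n ≫ R.succ) ≫ h = lift γ (n ≫ R.succ) ≫ k) : h = k :=
  R.funext (fst _ _ ≫ Γ ◁ R.succ ≫ k) h0 (fun Δ γ n => by rw [hs]; simp)
    (fun Δ γ n => by simp)

/-- Definition by cases: `f γ` at `(γ, 0)` and `g (γ, n)` at `(γ, n + 1)`. -/
def cases (f : Γ ⟶ X) (g : Γ ⊗ N ⟶ X) : Γ ⊗ N ⟶ X := R.recur f (fst _ _ ≫ g)

@[simp] lemma lift_zero_cases (f : Γ ⟶ X) (g : Γ ⊗ N ⟶ X) (γ : Δ ⟶ Γ) :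
    lift γ (R.zeroAt Δ) ≫ R.cases f g = γ ≫ f := R.lift_zero_recur _ _ _

@[simp] lemma lift_succ_cases (f : Γ ⟶ X) (g : Γ ⊗ N ⟶ X) (γ : Δ ⟶ Γ) (n : Δ ⟶ N) :
    lift γ (n ≫ R.succ) ≫ R.cases f g = lift γ n ≫ g := by
  rw [cases, lift_succ_recur]; simp

/-- The iterates `(x, n) ↦ tⁿ x`. -/
def iter (t : X ⟶ X) : X ⊗ N ⟶ X := R.recur (𝟙 X) (snd _ _ ≫ t)

@[simp] lemma lift_zero_iter (t : X ⟶ X) (x : Δ ⟶ X) :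
    lift x (R.zeroAt Δ) ≫ R.iter t = x := by
  rw [iter, lift_zero_recur, Category.comp_id]

@[simp] lemma lift_succ_iter (t : X ⟶ X) (x : Δ ⟶ X) (n : Δ ⟶ N) :
    lift x (n ≫ R.succ) ≫ R.iter t = (lift x n ≫ R.iter t) ≫ t := by
  rw [iter, lift_succ_recur]; simp

end NatObj

end Recursion

section ParamRecursion

variable {C : Type u} [Category.{v} C] [CartesianMonoidalCategory C] [Model C]

namespace NatObj

variable {N : C} (R : NatObj N) {Γ Δ X : C}

/-- Uniqueness of the predicate with `h (γ, n + 1) = h (s (γ, n), n)` and given `h (γ, 0)`. -/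
lemma pred_ext {h k : Γ ⊗ N ⟶ Sig C} (s : Γ ⊗ N ⟶ Γ)
    (h0 : ∀ (Δ : C) (γ : Δ ⟶ Γ), lift γ (R.zeroAt Δ) ≫ h = lift γ (R.zeroAt Δ) ≫ k)
    (hh : ∀ (Δ : C) (γ : Δ ⟶ Γ) (n : Δ ⟶ N),
      lift γ (n ≫ R.succ) ≫ h = lift (lift γ n ≫ s) n ≫ h)
    (hk : ∀ (Δ : C) (γ : Δ ⟶ Γ) (n : Δ ⟶ N),
      lift γ (n ≫ R.succ) ≫ k = lift (lift γ n ≫ s) n ≫ k) : h = k := by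
  -- the transpose `n ↦ λ γ. h (γ, n)` obeys an ordinary primitive recursion
  let T (h : Γ ⊗ N ⟶ Sig C) : 𝟙_ C ⊗ N ⟶ Pow Γ :=
    lam (lift (snd (𝟙_ C ⊗ N) Γ) (fst (𝟙_ C ⊗ N) Γ ≫ snd _ _) ≫ h)
  have hT (h : Γ ⊗ N ⟶ Sig C) {Δ : C} (e : Δ ⟶ 𝟙_ C) (n : Δ ⟶ N) (γ : Δ ⟶ Γ) :
      app (lift e n ≫ T h) γ = lift γ n ≫ h := by
    simp [T, ← Category.assoc]
  have key : T h = T k := by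
    refine R.funext (lam (app (fst _ _ ≫ snd _ (Pow Γ))
      (lift (snd _ Γ) (fst _ Γ ≫ fst _ _ ≫ snd _ N) ≫ s))) ?_ ?_ ?_
    · intro Δ γ
      apply pow_ext
      intro Θ θ x
      simpa [← Category.assoc, hT] using h0 Θ x
    all_goals
      intro Δ γ n
      apply pow_ext
      intro Θ θ x
      simp [← Category.assoc, hT, hh, hk]
  apply tensor_ext
  intro Δ γ n
  rw [← hT h (toUnit _), ← hT k (toUnit _), key]

/-- Existence of the predicate with `h (γ, n + 1) = h (s (γ, n), n)` and given `h (γ, 0)`,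
by recursion on `λ γ. h (γ, n)`. -/
lemma exists_pred (f : Γ ⟶ Sig C) (s : Γ ⊗ N ⟶ Γ) : ∃ h : Γ ⊗ N ⟶ Sig C,
    (∀ (Δ : C) (γ : Δ ⟶ Γ), lift γ (R.zeroAt Δ) ≫ h = γ ≫ f) ∧
    (∀ (Δ : C) (γ : Δ ⟶ Γ) (n : Δ ⟶ N),
      lift γ (n ≫ R.succ) ≫ h = lift (lift γ n ≫ s) n ≫ h) := by
  let r : 𝟙_ C ⊗ N ⟶ Pow Γ := R.recur (lam (snd _ _ ≫ f))
    (lam (app (fst _ _ ≫ snd _ (Pow Γ))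
      (lift (snd _ Γ) (fst _ Γ ≫ fst _ _ ≫ snd _ N) ≫ s)))
  have r0 {Δ : C} (e : Δ ⟶ 𝟙_ C) (γ : Δ ⟶ Γ) :
      app (lift e (R.zeroAt Δ) ≫ r) γ = γ ≫ f := by
    rw [R.lift_zero_recur]
    simp
  have rs {Δ : C} (e : Δ ⟶ 𝟙_ C) (n : Δ ⟶ N) (γ : Δ ⟶ Γ) :
      app (lift e (n ≫ R.succ) ≫ r) γ = app (lift e n ≫ r) (lift γ n ≫ s) := by
    rw [R.lift_succ_recur]
    simp [← Category.assoc, r]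
  refine ⟨app (lift (toUnit _) (snd _ _) ≫ r) (fst _ _), fun Δ γ => ?_, fun Δ γ n => ?_⟩
  · simp [← Category.assoc, r0]
  · simp [← Category.assoc, rs]

/-- Parameters may change in the course of a recursion: uniqueness of the function with
`h (γ, n + 1) = g (γ, n, h (s (γ, n), n))` and given `h (γ, 0)`. Apply `pred_ext` to
`φ (h (γ, n))`, with `φ` as a further parameter. -/
lemma param_ext {h k : Γ ⊗ N ⟶ X} (s : Γ ⊗ N ⟶ Γ) (g : (Γ ⊗ N) ⊗ X ⟶ X)
    (h0 : ∀ (Δ : C) (γ : Δ ⟶ Γ), lift γ (R.zeroAt Δ) ≫ h = lift γ (R.zeroAt Δ) ≫ k)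
    (hh : ∀ (Δ : C) (γ : Δ ⟶ Γ) (n : Δ ⟶ N),
      lift γ (n ≫ R.succ) ≫ h = lift (lift γ n) (lift (lift γ n ≫ s) n ≫ h) ≫ g)
    (hk : ∀ (Δ : C) (γ : Δ ⟶ Γ) (n : Δ ⟶ N),
      lift γ (n ≫ R.succ) ≫ k = lift (lift γ n) (lift (lift γ n ≫ s) n ≫ k) ≫ g) :
    h = k := by
  let T (h : Γ ⊗ N ⟶ X) : (Γ ⊗ Pow X) ⊗ N ⟶ Sig C :=
    app (fst _ _ ≫ snd _ _) (lift (fst _ _ ≫ fst _ _) (snd _ _) ≫ h)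
  have hT (h : Γ ⊗ N ⟶ X) {Δ : C} (γ : Δ ⟶ Γ) (φ : Δ ⟶ Pow X) (n : Δ ⟶ N) :
      lift (lift γ φ) n ≫ T h = app φ (lift γ n ≫ h) := by
    simp [T, ← Category.assoc]
  have hp {Δ : C} (γ : Δ ⟶ Γ ⊗ Pow X) : γ = lift (γ ≫ fst _ _) (γ ≫ snd _ _) := by simp
  have key : T h = T k := by
    refine R.pred_ext
      (lift (lift (fst _ _ ≫ fst _ _) (snd _ _) ≫ s)
        (lam (app (fst ((Γ ⊗ Pow X) ⊗ N) X ≫ fst _ _ ≫ snd _ _)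
          (lift (lift (fst _ _ ≫ fst _ _ ≫ fst _ _) (fst _ _ ≫ snd _ _)) (snd _ _) ≫ g))))
      ?_ ?_ ?_
    · intro Δ γ
      rw [hp γ, hT, hT, h0]
    all_goals
      intro Δ γ n
      rw [hp γ]
      simp [-lift_comp_fst_snd, hT, hh, hk, ← Category.assoc]
  apply tensor_ext
  intro Δ γ n
  apply point_ext
  intro Θ θ φ
  have := congrArg (fun t => lift (lift (θ ≫ γ) φ) (θ ≫ n) ≫ t) key
  simpa [hT, ← Category.assoc] using this

/-- Parameters may change in the course of a recursion: existence of the function with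
`h (γ, n + 1) = g (γ, n, h (s (γ, n), n))` and given `h (γ, 0)`. The predicate `φ (h (γ, n))` is
given by `exists_pred`, with `φ` as a further parameter; it is prime by induction. -/
lemma exists_param (f : Γ ⟶ X) (s : Γ ⊗ N ⟶ Γ) (g : (Γ ⊗ N) ⊗ X ⟶ X) : ∃ h : Γ ⊗ N ⟶ X,
    (∀ (Δ : C) (γ : Δ ⟶ Γ), lift γ (R.zeroAt Δ) ≫ h = γ ≫ f) ∧
    (∀ (Δ : C) (γ : Δ ⟶ Γ) (n : Δ ⟶ N),
      lift γ (n ≫ R.succ) ≫ h = lift (lift γ n) (lift (lift γ n ≫ s) n ≫ h) ≫ g) := by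
  -- `pull (γ, n, φ) = λ x. φ (g (γ, n, x))`
  let pull : (Γ ⊗ N) ⊗ Pow X ⟶ Pow X := lam (app (fst _ X ≫ snd _ _)
    (lift (fst _ X ≫ fst _ _) (snd _ X) ≫ g))
  have hpull {Δ : C} (c : Δ ⟶ Γ ⊗ N) (φ : Δ ⟶ Pow X) (x : Δ ⟶ X) :
      app (lift c φ ≫ pull) x = app φ (lift c x ≫ g) := by
    simp [pull, ← Category.assoc]
  obtain ⟨r, r0, rs⟩ := R.exists_pred (Γ := Γ ⊗ Pow X) (app (snd _ _) (fst _ _ ≫ f))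
    (lift (lift (fst _ _ ≫ fst _ _) (snd _ _) ≫ s)
      (lift (lift (fst _ _ ≫ fst _ _) (snd _ _)) (fst _ _ ≫ snd _ _) ≫ pull))
  have r0' {Δ : C} (γ : Δ ⟶ Γ) (φ : Δ ⟶ Pow X) :
      lift (lift γ φ) (R.zeroAt Δ) ≫ r = app φ (γ ≫ f) := by
    rw [r0]
    simp [← Category.assoc]
  have rs' {Δ : C} (γ : Δ ⟶ Γ) (φ : Δ ⟶ Pow X) (n : Δ ⟶ N) :
      lift (lift γ φ) (n ≫ R.succ) ≫ r =
        lift (lift (lift γ n ≫ s) (lift (lift γ n) φ ≫ pull)) n ≫ r := by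
    rw [rs]
    simp [← Category.assoc]
  let P : Γ ⊗ N ⟶ Pow (Pow X) :=
    lam (lift (lift (fst _ _ ≫ fst _ _) (snd _ _)) (fst _ _ ≫ snd _ _) ≫ r)
  have hP {Δ : C} (γ : Δ ⟶ Γ) (n : Δ ⟶ N) (φ : Δ ⟶ Pow X) :
      app (lift γ n ≫ P) φ = lift (lift γ φ) n ≫ r := by
    simp [P, ← Category.assoc]
  have hprime : IsPrime P := by
    -- both sides of the equation, as predicates of `γ`, `𝓕` and `n`
    let lhs : (Γ ⊗ Pow (Pow (Pow X))) ⊗ N ⟶ Sig C :=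
      app (fst _ _ ≫ snd _ _) (lift (fst _ _ ≫ fst _ _) (snd _ _) ≫ P)
    let rhs : (Γ ⊗ Pow (Pow (Pow X))) ⊗ N ⟶ Sig C :=
      app (lift (fst _ _ ≫ fst _ _) (snd _ _) ≫ P)
        (lam (app (fst _ X ≫ fst _ _ ≫ snd _ _) (snd _ X ≫ unit X)))
    have hl {Δ : C} (γ : Δ ⟶ Γ) (F : Δ ⟶ Pow (Pow (Pow X))) (n : Δ ⟶ N) :
        lift (lift γ F) n ≫ lhs = app F (lift γ n ≫ P) := by
      simp [lhs, ← Category.assoc]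
    have hr {Δ : C} (γ : Δ ⟶ Γ) (F : Δ ⟶ Pow (Pow (Pow X))) (n : Δ ⟶ N) :
        lift (lift γ F) n ≫ rhs =
          app (lift γ n ≫ P) (lam (app (fst _ X ≫ F) (snd _ X ≫ unit X))) := by
      simp [rhs, ← Category.assoc, comp_lam]
    have hp {Δ : C} (γ : Δ ⟶ Γ ⊗ Pow (Pow (Pow X))) :
        γ = lift (γ ≫ fst _ _) (γ ≫ snd _ _) := by simp
    -- `push (γ, n, 𝓕) = λ P. 𝓕 (λ φ. P (pull (γ, n, φ)))`
    let push : (Γ ⊗ N) ⊗ Pow (Pow (Pow X)) ⟶ Pow (Pow (Pow X)) :=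
      lam (app (fst _ (Pow (Pow X)) ≫ snd _ _) (lam (app (fst _ (Pow X) ≫ snd _ (Pow (Pow X)))
        (lift (fst _ (Pow X) ≫ fst _ _ ≫ fst _ _) (snd _ (Pow X)) ≫ pull))))
    have key : lhs = rhs := by
      refine R.pred_ext
        (lift (lift (fst _ _ ≫ fst _ _) (snd _ _) ≫ s)
          (lift (lift (fst _ _ ≫ fst _ _) (snd _ _)) (fst _ _ ≫ snd _ _) ≫ push)) ?_ ?_ ?_
      · intro Δ γ
        rw [hp γ, hl, hr, hP, r0', app_lam]
        simp only [← Category.assoc, comp_app, lift_fst, lift_snd]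
        congr 1
        · simp
        apply pow_ext
        intro Θ θ φ
        simp only [← Category.assoc, comp_lift, comp_toUnit, hP, r0', app_comp_unit]
      · intro Δ γ n
        rw [hp γ, hl]
        simp only [← Category.assoc, lift_fst, lift_snd, comp_lift, hl]
        simp only [push, app_comp_lam, ← Category.assoc, comp_app, lift_fst, lift_snd]
        congr 1
        apply pow_ext
        intro Θ θ φ
        simp only [← Category.assoc, comp_lift, hP, rs', app_comp_lam, comp_app, lift_fst,
          lift_snd]
      · intro Δ γ n
        rw [hp γ, hr, hP, rs']
        simp only [← Category.assoc, lift_fst, lift_snd, comp_lift, hr, hP]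
        congr 3
        apply pow_ext
        intro Θ θ x
        rw [← Category.assoc, comp_lift, hpull]
        simp only [push, app_comp_lam, ← Category.assoc, comp_app, lift_fst, lift_snd, comp_lift]
        congr 1
        apply pow_ext
        intro Ξ ξ φ
        simp [← Category.assoc, hpull]
    intro Δ c F
    have := congrArg (fun t => lift (lift (c ≫ fst _ _) F) (c ≫ snd _ _) ≫ t) key
    simp only [hl, hr, lift_comp_fst_snd] at this
    exact this
  obtain ⟨h, hh, -⟩ := Model.sober P hprime
  have ha {Δ : C} (γ : Δ ⟶ Γ) (n : Δ ⟶ N) (φ : Δ ⟶ Pow X) :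
      app φ (lift γ n ≫ h) = lift (lift γ φ) n ≫ r := by
    rw [← hP, ← hh, ← Category.assoc, app_comp_unit]
  refine ⟨h, fun Δ γ => ?_, fun Δ γ n => ?_⟩
  · apply point_ext
    intro Θ θ φ
    simp only [← Category.assoc, comp_lift, comp_toUnit, ha, r0']
  · apply point_ext
    intro Θ θ φ
    simp only [← Category.assoc, comp_lift, ha, rs']
    rw [← ha, hpull]

end NatObj

end ParamRecursion

end ASD

/-! ### Arithmetic and pairing -/

namespace ASD

section Arithmetic

variable {C : Type u} [Category.{v} C] [CartesianMonoidalCategory C]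

namespace NatObj

variable {N : C} (R : NatObj N) {Γ Δ X Y : C}

/-- Functions of one variable that obey the same primitive recursion are equal. -/
lemma funext₁ {h k : N ⟶ X} (g : N ⊗ X ⟶ X)
    (h0 : ∀ Δ : C, R.zeroAt Δ ≫ h = R.zeroAt Δ ≫ k)
    (hh : ∀ (Δ : C) (n : Δ ⟶ N), (n ≫ R.succ) ≫ h = lift n (n ≫ h) ≫ g)
    (hk : ∀ (Δ : C) (n : Δ ⟶ N), (n ≫ R.succ) ≫ k = lift n (n ≫ k) ≫ g) : h = k := by
  have key : snd (𝟙_ C) N ≫ h = snd (𝟙_ C) N ≫ k := by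
    refine R.funext (lift (fst _ X ≫ snd _ _) (snd _ _) ≫ g) (fun Δ γ => ?_) (fun Δ γ n => ?_)
      (fun Δ γ n => ?_)
    · simpa [← Category.assoc] using h0 Δ
    · simpa [← Category.assoc] using hh Δ n
    · simpa [← Category.assoc] using hk Δ n
  have := congrArg (fun t => lift (toUnit N) (𝟙 N) ≫ t) key
  simpa [← Category.assoc] using this

/-- Definition by cases for functions of one variable. -/
def cases₁ (x : 𝟙_ C ⟶ X) (g : N ⟶ X) : N ⟶ X :=
  lift (toUnit N) (𝟙 N) ≫ R.cases x (snd _ _ ≫ g)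

@[simp] lemma zero_cases₁ (x : 𝟙_ C ⟶ X) (g : N ⟶ X) :
    R.zeroAt Δ ≫ R.cases₁ x g = toUnit Δ ≫ x := by
  simp only [cases₁, ← Category.assoc, comp_lift, comp_toUnit, Category.comp_id, lift_zero_cases]

@[simp] lemma succ_cases₁ (x : 𝟙_ C ⟶ X) (g : N ⟶ X) (n : Δ ⟶ N) :
    (n ≫ R.succ) ≫ R.cases₁ x g = n ≫ g := by
  simp only [cases₁, ← Category.assoc, comp_lift, comp_toUnit, Category.comp_id, lift_succ_cases,
    lift_snd]

/-- The iterates of semiconjugate maps are semiconjugate. -/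
lemma iter_semiconj {t : X ⟶ X} {q : X ⟶ Y} {t' : Y ⟶ Y} (h : t ≫ q = q ≫ t') (x : Δ ⟶ X)
    (n : Δ ⟶ N) : (lift x n ≫ R.iter t) ≫ q = lift (x ≫ q) n ≫ R.iter t' := by
  have key : R.iter t ≫ q = lift (fst X N ≫ q) (snd X N) ≫ R.iter t' := by
    refine R.funext (snd _ _ ≫ t') (fun Δ γ => ?_) (fun Δ γ n => ?_) (fun Δ γ n => ?_)
    · simp [← Category.assoc]
    · simp only [← Category.assoc, lift_succ_iter, lift_snd]
      simp only [Category.assoc, h]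
    · simp [← Category.assoc]
  rw [Category.assoc, key]
  simp [← Category.assoc]

lemma lift_comp_iter (t : X ⟶ X) (x : Δ ⟶ X) (n : Δ ⟶ N) :
    lift (x ≫ t) n ≫ R.iter t = lift x (n ≫ R.succ) ≫ R.iter t := by
  rw [lift_succ_iter, R.iter_semiconj rfl]

/-- Addition. -/
def add : N ⊗ N ⟶ N := R.iter R.succ

@[simp] lemma add_zero (a : Δ ⟶ N) : lift a (R.zeroAt Δ) ≫ R.add = a := R.lift_zero_iter _ _

@[simp] lemma add_succ (a b : Δ ⟶ N) :
    lift a (b ≫ R.succ) ≫ R.add = (lift a b ≫ R.add) ≫ R.succ := R.lift_succ_iter _ _ _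

@[simp] lemma succ_add (a b : Δ ⟶ N) :
    lift (a ≫ R.succ) b ≫ R.add = (lift a b ≫ R.add) ≫ R.succ := R.lift_comp_iter _ _ _ |>.trans
  (R.add_succ a b)

@[simp] lemma zero_add (a : Δ ⟶ N) : lift (R.zeroAt Δ) a ≫ R.add = a := by
  have key : lift (R.zeroAt N) (𝟙 N) ≫ R.add = 𝟙 N := by
    refine R.funext₁ (snd _ _ ≫ R.succ) (fun Δ => ?_) (fun Δ n => ?_) (fun Δ n => ?_)
    all_goals simp [← Category.assoc]
  simpa [← Category.assoc] using congrArg (fun t => a ≫ t) key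

lemma add_comm (a b : Δ ⟶ N) : lift a b ≫ R.add = lift b a ≫ R.add := by
  have key : R.add = lift (snd N N) (fst N N) ≫ R.add := by
    refine R.funext (snd _ _ ≫ R.succ) (fun Δ γ => ?_) (fun Δ γ n => ?_) (fun Δ γ n => ?_)
    all_goals simp [← Category.assoc]
  simpa [← Category.assoc] using congrArg (fun t => lift a b ≫ t) key

lemma add_assoc (a b c : Δ ⟶ N) :
    lift (lift a b ≫ R.add) c ≫ R.add = lift a (lift b c ≫ R.add) ≫ R.add := by
  have key : lift (fst (N ⊗ N) N ≫ R.add) (snd (N ⊗ N) N) ≫ R.add =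
      lift (fst (N ⊗ N) N ≫ fst N N) (lift (fst (N ⊗ N) N ≫ snd N N) (snd (N ⊗ N) N) ≫ R.add) ≫
        R.add := by
    refine R.funext (snd _ _ ≫ R.succ) (fun Δ γ => ?_) (fun Δ γ n => ?_) (fun Δ γ n => ?_)
    all_goals simp [← Category.assoc]
  simpa [← Category.assoc] using congrArg (fun t => lift (lift a b) c ≫ t) key

lemma eq_zero_of_add_eq_zero (a b : Δ ⟶ N) (h : lift a b ≫ R.add = R.zeroAt Δ) :
    b = R.zeroAt Δ := by
  -- `F (y, x)` is `0` if `x = 0`, and `y` otherwise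
  let F : N ⊗ N ⟶ N := R.cases (R.zeroAt N) (fst N N)
  have h0 : lift (R.zeroAt N) (𝟙 N) ≫ F = R.zeroAt N := by
    refine R.funext₁ (toUnit _ ≫ R.zero) (fun Δ => ?_) (fun Δ n => ?_) (fun Δ n => ?_)
    all_goals simp [← Category.assoc, F]
  have h0' {Δ : C} (a : Δ ⟶ N) : lift (R.zeroAt Δ) a ≫ F = R.zeroAt Δ := by
    simpa [← Category.assoc] using congrArg (fun t => a ≫ t) h0
  have key : lift (snd N N) R.add ≫ F = snd N N := by
    refine R.cases_ext (fun Δ γ => ?_) (fun Δ γ n => ?_)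
    · simp [← Category.assoc, h0']
    · simp [← Category.assoc, F]
  have := congrArg (fun t => lift a b ≫ t) key
  simp only [← Category.assoc, comp_lift, lift_snd, h] at this
  simpa [F] using this.symm

/-- Predecessor, with `pred 0 = 0`. -/
def pred : N ⟶ N := R.cases₁ R.zero (𝟙 N)

@[simp] lemma zero_pred : R.zeroAt Δ ≫ R.pred = R.zeroAt Δ := R.zero_cases₁ _ _

@[simp] lemma succ_pred (n : Δ ⟶ N) : (n ≫ R.succ) ≫ R.pred = n :=
  (R.succ_cases₁ _ _ _).trans (Category.comp_id n)

lemma iter_pred_self (n : Δ ⟶ N) : lift n n ≫ R.iter R.pred = R.zeroAt Δ := by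
  have key : lift (𝟙 N) (𝟙 N) ≫ R.iter R.pred = R.zeroAt N := by
    refine R.funext₁ (snd _ _) (fun Δ => ?_) (fun Δ n => ?_) (fun Δ n => ?_)
    · simp only [← Category.assoc, comp_lift, Category.comp_id, lift_zero_iter, comp_toUnit]
    · simp only [← Category.assoc, comp_lift, Category.comp_id, lift_snd]
      rw [← R.lift_comp_iter, succ_pred]
    · simp [← Category.assoc]
  simpa [← Category.assoc] using congrArg (fun t => n ≫ t) key

/-- The triangular numbers: `tri 0 = 0` and `tri (n + 1) = tri n + n + 1`. -/
def tri : N ⟶ N := lift (toUnit N) (𝟙 N) ≫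
  R.recur R.zero (lift (snd _ _) (fst _ _ ≫ snd _ _) ≫ R.add ≫ R.succ)

@[simp] lemma tri_zero : R.zeroAt Δ ≫ R.tri = R.zeroAt Δ := by
  simp only [tri, ← Category.assoc, comp_lift, comp_toUnit, Category.comp_id, lift_zero_recur]

@[simp] lemma tri_succ (n : Δ ⟶ N) :
    (n ≫ R.succ) ≫ R.tri = (lift (n ≫ R.tri) n ≫ R.add) ≫ R.succ := by
  simp [tri, ← Category.assoc, lift_succ_recur]

/-- Cantor's pairing function: the position `tri (a + b) + a` of `(a, b)` in the enumeration of
`N × N` along diagonals. -/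
def pair : N ⊗ N ⟶ N := lift (R.add ≫ R.tri) (fst N N) ≫ R.add

lemma lift_pair (a b : Δ ⟶ N) :
    lift a b ≫ R.pair = lift ((lift a b ≫ R.add) ≫ R.tri) a ≫ R.add := by
  simp [pair, ← Category.assoc]

/-- The successor of a pair in the enumeration along diagonals. -/
def step : N ⊗ N ⟶ N ⊗ N :=
  R.cases (lift (R.zeroAt N) R.succ) (lift (fst N N ≫ R.succ) (snd N N))

@[simp] lemma lift_zero_step (a : Δ ⟶ N) :
    lift a (R.zeroAt Δ) ≫ R.step = lift (R.zeroAt Δ) (a ≫ R.succ) := by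
  simp [step, ← Category.assoc]

@[simp] lemma lift_succ_step (a b : Δ ⟶ N) :
    lift a (b ≫ R.succ) ≫ R.step = lift (a ≫ R.succ) b := by
  simp [step, ← Category.assoc]

lemma step_pair : R.step ≫ R.pair = R.pair ≫ R.succ := by
  refine R.cases_ext (fun Δ a => ?_) (fun Δ a b => ?_)
  · simp [← Category.assoc, lift_pair]
  · simp [← Category.assoc, lift_pair]

/-- The enumeration of `N × N` along diagonals. -/
def unpair : N ⟶ N ⊗ N := lift (lift (R.zeroAt N) (R.zeroAt N)) (𝟙 N) ≫ R.iter R.step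

@[simp] lemma zero_unpair : R.zeroAt Δ ≫ R.unpair = lift (R.zeroAt Δ) (R.zeroAt Δ) := by
  simp only [unpair, ← Category.assoc, comp_lift, comp_toUnit, Category.comp_id, lift_zero_iter]

@[simp] lemma succ_unpair (n : Δ ⟶ N) : (n ≫ R.succ) ≫ R.unpair = (n ≫ R.unpair) ≫ R.step := by
  simp [unpair, ← Category.assoc]

lemma unpair_comp_pair : R.unpair ≫ R.pair = 𝟙 N := by
  refine R.funext₁ (snd _ _ ≫ R.succ) (fun Δ => ?_) (fun Δ n => ?_) (fun Δ n => ?_)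
  · simp [← Category.assoc, lift_pair]
  · simp only [← Category.assoc, succ_unpair, lift_snd]
    simp only [Category.assoc, step_pair]
  · simp

@[simp] lemma unpair_pair (n : Δ ⟶ N) : (n ≫ R.unpair) ≫ R.pair = n := by
  rw [Category.assoc, unpair_comp_pair, Category.comp_id]

lemma add_unpair (c a : Δ ⟶ N) :
    (lift c a ≫ R.add) ≫ R.unpair = lift (c ≫ R.unpair) a ≫ R.iter R.step := by
  have key : R.add ≫ R.unpair = lift (fst N N ≫ R.unpair) (snd N N) ≫ R.iter R.step := by
    refine R.funext (snd _ _ ≫ R.step) (fun Δ γ => ?_) (fun Δ γ n => ?_) (fun Δ γ n => ?_)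
    all_goals simp [← Category.assoc]
  simpa [← Category.assoc] using congrArg (fun t => lift c a ≫ t) key

/-- The tail of a list of numbers, where `[]` is coded by `0` and `n :: l` by `pair (l, n) + 1`. -/
def tail : N ⟶ N := R.cases₁ R.zero (R.unpair ≫ fst N N)

@[simp] lemma zero_tail : R.zeroAt Δ ≫ R.tail = R.zeroAt Δ := R.zero_cases₁ _ _

@[simp] lemma succ_tail (m : Δ ⟶ N) : (m ≫ R.succ) ≫ R.tail = (m ≫ R.unpair) ≫ fst N N := by
  rw [tail, succ_cases₁, Category.assoc]

/-- A list with code `c` has length at most `c`. For the proof, each step from a non-empty list to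
its tail adds the decrement of the code, less one, to a counter `r`, and each step at the empty
list decrements `r`. Then `r` plus the code is `c ∸ k` after `k` steps. -/
lemma iter_tail_self (c : Δ ⟶ N) : lift c c ≫ R.iter R.tail = R.zeroAt Δ := by
  let st : N ⊗ N ⟶ N ⊗ N := R.cases (lift R.pred (R.zeroAt N))
    (lift (lift (fst N N) ((snd N N ≫ R.unpair) ≫ R.add ≫ R.tri) ≫ R.add)
      ((snd N N ≫ R.unpair) ≫ fst N N))
  have h1 : st ≫ snd N N = snd N N ≫ R.tail := by
    refine R.cases_ext (fun Δ a => ?_) (fun Δ a b => ?_)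
    all_goals simp [← Category.assoc, st]
  have h2 : st ≫ R.add = R.add ≫ R.pred := by
    refine R.cases_ext (fun Δ a => ?_) (fun Δ a b => ?_)
    · simp [← Category.assoc, st]
    · have hb : lift (((b ≫ R.unpair) ≫ R.add) ≫ R.tri) ((b ≫ R.unpair) ≫ fst N N) ≫ R.add =
          b := by
        conv_rhs => rw [← R.unpair_pair b]
        simp [pair, ← Category.assoc]
      simp [← Category.assoc, st, add_assoc, hb]
  have e1 := R.iter_semiconj h1 (lift (R.zeroAt Δ) c) c
  have e2 := R.iter_semiconj h2 (lift (R.zeroAt Δ) c) c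
  rw [lift_snd] at e1
  rw [zero_add, iter_pred_self] at e2
  rw [← e1]
  exact R.eq_zero_of_add_eq_zero ((lift (lift (R.zeroAt Δ) c) c ≫ R.iter st) ≫ fst N N) _
    (by rw [lift_comp_fst_snd, e2])

/-- One stage of the recursion for lists: `((γ, x), c)` is taken to `f γ` if `c` codes `[]`, and
to `g (γ, n, l, x)` if `c` codes `n :: l`. -/
def listStage (f : Γ ⟶ X) (g : (Γ ⊗ (N ⊗ N)) ⊗ X ⟶ X) : (Γ ⊗ X) ⊗ N ⟶ X :=
  R.cases (fst Γ X ≫ f)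
    (lift (lift (fst _ N ≫ fst Γ X) (lift ((snd _ N ≫ R.unpair) ≫ snd N N)
      ((snd _ N ≫ R.unpair) ≫ fst N N))) (fst _ N ≫ snd Γ X) ≫ g)

@[simp] lemma listStage_zero (f : Γ ⟶ X) (g : (Γ ⊗ (N ⊗ N)) ⊗ X ⟶ X) (γ : Δ ⟶ Γ) (x : Δ ⟶ X) :
    lift (lift γ x) (R.zeroAt Δ) ≫ R.listStage f g = γ ≫ f := by
  simp [listStage, ← Category.assoc]

lemma listStage_succ (f : Γ ⟶ X) (g : (Γ ⊗ (N ⊗ N)) ⊗ X ⟶ X) (γ : Δ ⟶ Γ) (x : Δ ⟶ X)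
    (m : Δ ⟶ N) :
    lift (lift γ x) (m ≫ R.succ) ≫ R.listStage f g = lift (lift γ (lift ((m ≫ R.unpair) ≫ snd N N)
      ((m ≫ R.unpair) ≫ fst N N))) x ≫ g := by
  simp [listStage, ← Category.assoc]

end NatObj

end Arithmetic

/-! ### Lists of numbers as numbers -/

section NatLists

variable {C : Type u} [Category.{v} C] [CartesianMonoidalCategory C] [Model C]

namespace NatObj

variable {N : C} (R : NatObj N) {Γ Δ X Y : C}

/-- `a` steps lead along a diagonal from `(x, b + a)` to `(x + a, b)`. -/
lemma iter_step (x b a : Δ ⟶ N) :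
    lift (lift x (lift b a ≫ R.add)) a ≫ R.iter R.step = lift (lift x a ≫ R.add) b := by
  have key : lift (lift (fst (N ⊗ N) N ≫ fst N N) (lift (fst (N ⊗ N) N ≫ snd N N)
      (snd (N ⊗ N) N) ≫ R.add)) (snd (N ⊗ N) N) ≫ R.iter R.step =
      lift (lift (fst (N ⊗ N) N ≫ fst N N) (snd (N ⊗ N) N) ≫ R.add)
        (fst (N ⊗ N) N ≫ snd N N) := by
    refine R.param_ext (lift (fst (N ⊗ N) N ≫ fst N N) (fst (N ⊗ N) N ≫ snd N N ≫ R.succ))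
      (snd _ _ ≫ R.step) (fun Δ γ => ?_) (fun Δ γ n => ?_) (fun Δ γ n => ?_)
    all_goals simp [← Category.assoc]
  simpa [← Category.assoc] using congrArg (fun t => lift (lift x b) a ≫ t) key

/-- The position `tri s` is that of the first pair `(0, s)` on the diagonal with sum `s`. -/
lemma tri_unpair (s : Δ ⟶ N) : (s ≫ R.tri) ≫ R.unpair = lift (R.zeroAt Δ) s := by
  have key : R.tri ≫ R.unpair = lift (R.zeroAt N) (𝟙 N) := by
    refine R.funext₁ ((lift (snd _ _) (fst _ _) ≫ R.iter R.step) ≫ R.step) (fun Δ => ?_)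
      (fun Δ n => ?_) (fun Δ n => ?_)
    · simp [← Category.assoc]
    · simp [← Category.assoc, add_unpair]
    · have := R.iter_step (R.zeroAt Δ) (R.zeroAt Δ) n
      simp only [zero_add] at this
      simp [← Category.assoc, this]
  simpa [← Category.assoc] using congrArg (fun t => s ≫ t) key

@[simp] lemma pair_unpair (a b : Δ ⟶ N) : (lift a b ≫ R.pair) ≫ R.unpair = lift a b := by
  rw [lift_pair, add_unpair, tri_unpair, R.add_comm a b, iter_step, zero_add]

@[simp] lemma listStage_cons (f : Γ ⟶ X) (g : (Γ ⊗ (N ⊗ N)) ⊗ X ⟶ X) (γ : Δ ⟶ Γ) (x : Δ ⟶ X)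
    (n l : Δ ⟶ N) :
    lift (lift γ x) ((lift l n ≫ R.pair) ≫ R.succ) ≫ R.listStage f g =
      lift (lift γ (lift n l)) x ≫ g := by
  rw [listStage_succ, pair_unpair, lift_fst, lift_snd]

/-- The function `unroll`, by a recursion on `k` in which the parameter `c` becomes `tail c`. -/
lemma exists_unroll (f : Γ ⟶ X) (g : (Γ ⊗ (N ⊗ N)) ⊗ X ⟶ X) :
    ∃ W : ((Γ ⊗ N) ⊗ X) ⊗ N ⟶ X,
      (∀ (Δ : C) (γ : Δ ⟶ Γ) (c : Δ ⟶ N) (x : Δ ⟶ X),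
        lift (lift (lift γ c) x) (R.zeroAt Δ) ≫ W = x) ∧
      (∀ (Δ : C) (γ : Δ ⟶ Γ) (c : Δ ⟶ N) (x : Δ ⟶ X) (k : Δ ⟶ N),
        lift (lift (lift γ c) x) (k ≫ R.succ) ≫ W =
          lift (lift γ (lift (lift (lift γ (c ≫ R.tail)) x) k ≫ W)) c ≫ R.listStage f g) := by
  obtain ⟨W, h0, hs⟩ := R.exists_param (Γ := (Γ ⊗ N) ⊗ X) (snd (Γ ⊗ N) X)
    (lift (lift ((fst _ N ≫ fst _ X) ≫ fst Γ N) (((fst _ N ≫ fst _ X) ≫ snd Γ N) ≫ R.tail))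
      (fst _ N ≫ snd _ X))
    (lift (lift (((fst _ X ≫ fst _ N) ≫ fst _ X) ≫ fst Γ N) (snd _ X))
      (((fst _ X ≫ fst _ N) ≫ fst _ X) ≫ snd Γ N) ≫ R.listStage f g)
  refine ⟨W, fun Δ γ c x => ?_, fun Δ γ c x k => ?_⟩
  · rw [h0, lift_snd]
  · rw [hs]
    simp [← Category.assoc]

/-- `unroll (γ, c, x, k)` applies the stages of the recursion for `c`, `tail c`, …,
`tailᵏ⁻¹ c` to the value `x` for `tailᵏ c`. -/
noncomputable def unroll (f : Γ ⟶ X) (g : (Γ ⊗ (N ⊗ N)) ⊗ X ⟶ X) : ((Γ ⊗ N) ⊗ X) ⊗ N ⟶ X :=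
  (R.exists_unroll f g).choose

variable (f : Γ ⟶ X) (g : (Γ ⊗ (N ⊗ N)) ⊗ X ⟶ X)

@[simp] lemma unroll_zero (γ : Δ ⟶ Γ) (c : Δ ⟶ N) (x : Δ ⟶ X) :
    lift (lift (lift γ c) x) (R.zeroAt Δ) ≫ R.unroll f g = x :=
  (R.exists_unroll f g).choose_spec.1 Δ γ c x

@[simp] lemma unroll_succ (γ : Δ ⟶ Γ) (c : Δ ⟶ N) (x : Δ ⟶ X) (k : Δ ⟶ N) :
    lift (lift (lift γ c) x) (k ≫ R.succ) ≫ R.unroll f g =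
      lift (lift γ (lift (lift (lift γ (c ≫ R.tail)) x) k ≫ R.unroll f g)) c ≫
        R.listStage f g :=
  (R.exists_unroll f g).choose_spec.2 Δ γ c x k

/-- At the empty list, the number of stages does not matter. -/
lemma unroll_nil (γ : Δ ⟶ Γ) (k : Δ ⟶ N) :
    lift (lift (lift γ (R.zeroAt Δ)) (γ ≫ f)) k ≫ R.unroll f g = γ ≫ f := by
  have key : lift (lift (lift (fst Γ N) (R.zeroAt (Γ ⊗ N))) (fst Γ N ≫ f)) (snd Γ N) ≫
      R.unroll f g = fst Γ N ≫ f := by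
    refine R.cases_ext (fun Δ γ => ?_) (fun Δ γ n => ?_)
    all_goals simp [← Category.assoc]
  simpa [← Category.assoc] using congrArg (fun t => lift γ k ≫ t) key

/-- To unroll `e + k` stages, unroll `k` of them, starting from the value for `tailᵏ c` that is
obtained with the other `e` stages. -/
lemma unroll_add (γ : Δ ⟶ Γ) (c : Δ ⟶ N) (x : Δ ⟶ X) (e k : Δ ⟶ N) :
    lift (lift (lift γ c) x) (lift e k ≫ R.add) ≫ R.unroll f g =
      lift (lift (lift γ c) (lift (lift (lift γ (lift c k ≫ R.iter R.tail)) x) e ≫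
        R.unroll f g)) k ≫ R.unroll f g := by
  let γ' := fst (((Γ ⊗ N) ⊗ X) ⊗ N) N ≫ fst _ N ≫ fst _ X ≫ fst Γ N
  let c' := fst (((Γ ⊗ N) ⊗ X) ⊗ N) N ≫ fst _ N ≫ fst _ X ≫ snd Γ N
  let x' := fst (((Γ ⊗ N) ⊗ X) ⊗ N) N ≫ fst _ N ≫ snd _ X
  let e' := fst (((Γ ⊗ N) ⊗ X) ⊗ N) N ≫ snd _ N
  let k' := snd (((Γ ⊗ N) ⊗ X) ⊗ N) N
  have key : lift (lift (lift γ' c') x') (lift e' k' ≫ R.add) ≫ R.unroll f g =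
      lift (lift (lift γ' c') (lift (lift (lift γ' (lift c' k' ≫ R.iter R.tail)) x') e' ≫
        R.unroll f g)) k' ≫ R.unroll f g := by
    refine R.param_ext (lift (lift (lift γ' (c' ≫ R.tail)) x') e')
      (lift (lift (fst _ X ≫ γ') (snd _ X)) (fst _ X ≫ c') ≫ R.listStage f g)
      (fun Δ p => ?_) (fun Δ p n => ?_) (fun Δ p n => ?_)
    all_goals
      obtain ⟨p, e, rfl⟩ := exists_eq_lift p
      obtain ⟨p, x, rfl⟩ := exists_eq_lift p
      obtain ⟨γ, c, rfl⟩ := exists_eq_lift p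
      simp [← Category.assoc, γ', c', x', e', k', lift_comp_iter, -lift_succ_iter]
  simpa [← Category.assoc, γ', c', x', e', k'] using
    congrArg (fun t => lift (lift (lift (lift γ c) x) e) k ≫ t) key

/-- Lists of numbers are coded by numbers: `[]` by `0` and `n :: l` by `pair (l, n) + 1`.
The recursion at the code `c` unrolls `c` stages, by which time the list is exhausted. -/
noncomputable def listObj : ListObj N N where
  nil := R.zero
  cons := lift (snd N N) (fst N N) ≫ R.pair ≫ R.succ
  recur {Γ X} f g := lift (lift (𝟙 (Γ ⊗ N)) (fst Γ N ≫ f)) (snd Γ N) ≫ R.unroll f g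
  recur_nil f g := by
    simp [← Category.assoc]
  recur_cons {Γ X} f g := by
    apply tensor_ext
    intro Δ γ a
    obtain ⟨n, l, rfl⟩ := exists_eq_lift a
    -- `tail` takes the code `pair (l, n) + 1` to `l`, leaving `pair (l, n)` stages to unroll,
    -- and `l` of them are enough, as `pair (l, n) = tri (l + n) + l`
    have h : lift (lift (lift γ l) (γ ≫ f)) (lift l n ≫ R.pair) ≫ R.unroll f g =
        lift (lift (lift γ l) (γ ≫ f)) l ≫ R.unroll f g := by
      rw [lift_pair, unroll_add, iter_tail_self, unroll_nil]
    simp [← Category.assoc, h]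
  recur_unique {Γ X} f g h hnil hcons := by
    have h0 {Δ : C} (γ : Δ ⟶ Γ) : lift γ (R.zeroAt Δ) ≫ h = γ ≫ f := by
      simpa [← Category.assoc] using congrArg (fun t => γ ≫ t) hnil
    have h1 {Δ : C} (γ : Δ ⟶ Γ) (n l : Δ ⟶ N) :
        lift γ ((lift l n ≫ R.pair) ≫ R.succ) ≫ h =
          lift (lift γ (lift n l)) (lift γ l ≫ h) ≫ g := by
      simpa [← Category.assoc] using congrArg (fun t => lift γ (lift n l) ≫ t) hcons
    -- the recursion equations, combined into one
    have h2 : h = lift (lift (fst Γ N) (lift (fst Γ N) (snd Γ N ≫ R.tail) ≫ h)) (snd Γ N) ≫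
        R.listStage f g := by
      refine R.cases_ext (fun Δ γ => ?_) (fun Δ γ m => ?_)
      · simp [← Category.assoc, h0]
      · have := h1 γ ((m ≫ R.unpair) ≫ snd N N) ((m ≫ R.unpair) ≫ fst N N)
        simp only [lift_comp_fst_snd, unpair_pair] at this
        simp [← Category.assoc, listStage_succ, this]
    have h3 {Δ : C} (γ : Δ ⟶ Γ) (c : Δ ⟶ N) :
        lift γ c ≫ h = lift (lift γ (lift γ (c ≫ R.tail) ≫ h)) c ≫ R.listStage f g := by
      simpa [← Category.assoc] using congrArg (fun t => lift γ c ≫ t) h2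
    -- by iteration, `h (γ, c)` is obtained by unrolling `k` stages from `h (γ, tailᵏ c)`
    have key : fst (Γ ⊗ N) N ≫ h =
        lift (lift (fst (Γ ⊗ N) N) (lift (fst (Γ ⊗ N) N ≫ fst Γ N)
          (lift (fst (Γ ⊗ N) N ≫ snd Γ N) (snd (Γ ⊗ N) N) ≫ R.iter R.tail) ≫ h))
            (snd (Γ ⊗ N) N) ≫ R.unroll f g := by
      refine R.param_ext
        (lift (fst (Γ ⊗ N) N ≫ fst Γ N) ((fst (Γ ⊗ N) N ≫ snd Γ N) ≫ R.tail))
        (lift (lift (fst _ X ≫ fst _ N ≫ fst Γ N) (snd _ X)) (fst _ X ≫ fst _ N ≫ snd Γ N) ≫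
          R.listStage f g) (fun Δ p => ?_) (fun Δ p n => ?_) (fun Δ p n => ?_)
      all_goals
        obtain ⟨γ, c, rfl⟩ := exists_eq_lift p
        simp [← Category.assoc, ← h3, lift_comp_iter, -lift_succ_iter]
    have hk := congrArg (fun t => lift (𝟙 (Γ ⊗ N)) (snd Γ N) ≫ t) key
    simpa [← Category.assoc, iter_tail_self, h0] using hk

end NatObj

end NatLists

end ASD

/-! ### Equality of natural numbers -/

namespace ASD

section NatDiscrete

variable {C : Type u} [Category.{v} C] [CartesianMonoidalCategory C] [Model C]

namespace NatObj

variable {N : C} (R : NatObj N) {Γ Δ X : C}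

/-- The open predicate `n = 0`. -/
def isZero : N ⟶ Sig C := R.cases₁ ⊤ ⊥

/-- The open predicate `n ≠ 0`. -/
def isSucc : N ⟶ Sig C := R.cases₁ ⊥ ⊤

@[simp] lemma zero_isZero : R.zeroAt Δ ≫ R.isZero = ⊤ := by rw [isZero, zero_cases₁, comp_top]

@[simp] lemma succ_isZero (n : Δ ⟶ N) : (n ≫ R.succ) ≫ R.isZero = ⊥ := by
  rw [isZero, succ_cases₁, comp_bot]

@[simp] lemma zero_isSucc : R.zeroAt Δ ≫ R.isSucc = ⊥ := by rw [isSucc, zero_cases₁, comp_bot]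

@[simp] lemma succ_isSucc (n : Δ ⟶ N) : (n ≫ R.succ) ≫ R.isSucc = ⊤ := by
  rw [isSucc, succ_cases₁, comp_top]

/-- The function `eqPred`, by a recursion on `n` in which the parameter `m` becomes `pred m`. -/
lemma exists_eq : ∃ e : N ⊗ N ⟶ Sig C,
    (∀ (Δ : C) (m : Δ ⟶ N), lift m (R.zeroAt Δ) ≫ e = m ≫ R.isZero) ∧
    (∀ (Δ : C) (m n : Δ ⟶ N),
      lift m (n ≫ R.succ) ≫ e = m ≫ R.isSucc ⊓ lift (m ≫ R.pred) n ≫ e) := by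
  obtain ⟨e, h0, hs⟩ := R.exists_param R.isZero (fst N N ≫ R.pred)
    (((fst (N ⊗ N) (Sig C) ≫ fst N N) ≫ R.isSucc) ⊓ snd (N ⊗ N) (Sig C))
  exact ⟨e, h0, fun Δ m n => by rw [hs]; simp [← Category.assoc]⟩

/-- Equality of numbers as an open predicate: `m = 0` is decided by cases, and `m = n + 1` holds
if `m ≠ 0` and `pred m = n`. -/
noncomputable def eqPred : N ⊗ N ⟶ Sig C := R.exists_eq.choose

@[simp] lemma eqPred_zero (m : Δ ⟶ N) : lift m (R.zeroAt Δ) ≫ R.eqPred = m ≫ R.isZero :=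
  R.exists_eq.choose_spec.1 Δ m

@[simp] lemma eqPred_succ (m n : Δ ⟶ N) :
    lift m (n ≫ R.succ) ≫ R.eqPred = m ≫ R.isSucc ⊓ lift (m ≫ R.pred) n ≫ R.eqPred :=
  R.exists_eq.choose_spec.2 Δ m n

lemma eqPred_self (n : Δ ⟶ N) : lift n n ≫ R.eqPred = ⊤ := by
  have key : lift (𝟙 N) (𝟙 N) ≫ R.eqPred = ⊤ := by
    refine R.funext₁ (snd _ _) (fun Δ => ?_) (fun Δ n => ?_) (fun Δ n => ?_)
    · simp only [← Category.assoc, comp_lift, Category.comp_id, eqPred_zero, zero_isZero, comp_top]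
    · simp [← Category.assoc]
    · simp
  simpa [← Category.assoc] using congrArg (fun t => n ≫ t) key

lemma isZero_inf_app (φ : Δ ⟶ Pow N) (m : Δ ⟶ N) :
    m ≫ R.isZero ⊓ app φ m = m ≫ R.isZero ⊓ app φ (R.zeroAt Δ) := by
  have key : snd (Pow N) N ≫ R.isZero ⊓ app (fst (Pow N) N) (snd (Pow N) N) =
      snd (Pow N) N ≫ R.isZero ⊓ app (fst (Pow N) N) (R.zeroAt (Pow N ⊗ N)) := by
    refine R.cases_ext (fun Δ γ => ?_) (fun Δ γ n => ?_)
    all_goals simp [← Category.assoc]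
  simpa [← Category.assoc] using congrArg (fun t => lift φ m ≫ t) key

lemma isSucc_inf_app (φ : Δ ⟶ Pow N) (m : Δ ⟶ N) :
    m ≫ R.isSucc ⊓ app φ m = m ≫ R.isSucc ⊓ app φ ((m ≫ R.pred) ≫ R.succ) := by
  have key : snd (Pow N) N ≫ R.isSucc ⊓ app (fst (Pow N) N) (snd (Pow N) N) =
      snd (Pow N) N ≫ R.isSucc ⊓ app (fst (Pow N) N) ((snd (Pow N) N ≫ R.pred) ≫ R.succ) := by
    refine R.cases_ext (fun Δ γ => ?_) (fun Δ γ n => ?_)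
    all_goals simp [← Category.assoc]
  simpa [← Category.assoc] using congrArg (fun t => lift φ m ≫ t) key

/-- Equals may be substituted for one another in open predicates. Both sides obey the same
recursion on `n`, in which `m` becomes `pred m` and `φ` becomes `λ n. φ (n + 1)`. -/
lemma eqPred_inf_app (φ : Δ ⟶ Pow N) (m n : Δ ⟶ N) :
    lift m n ≫ R.eqPred ⊓ app φ m = lift m n ≫ R.eqPred ⊓ app φ n := by
  let m' := fst (N ⊗ Pow N) N ≫ fst N (Pow N)
  let φ' := fst (N ⊗ Pow N) N ≫ snd N (Pow N)
  let n' := snd (N ⊗ Pow N) N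
  have key : lift m' n' ≫ R.eqPred ⊓ app φ' m' = lift m' n' ≫ R.eqPred ⊓ app φ' n' := by
    refine R.param_ext (lift (m' ≫ R.pred) (φ' ≫ powMap R.succ))
      ((fst _ _ ≫ m') ≫ R.isSucc ⊓ snd _ _) (fun Δ p => ?_) (fun Δ p n => ?_) (fun Δ p n => ?_)
    all_goals obtain ⟨m, φ, rfl⟩ := exists_eq_lift p
    · simp [← Category.assoc, m', n', φ', isZero_inf_app]
    · simp only [← Category.assoc, m', n', φ', comp_inf, comp_app, comp_lift, lift_fst, lift_snd,
        eqPred_succ, app_comp_powMap]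
      rw [inf_right_comm, isSucc_inf_app, inf_assoc, inf_comm (app φ _)]
    · simp [← Category.assoc, m', n', φ', inf_assoc]
  simpa [← Category.assoc, m', n', φ'] using congrArg (fun t => lift (lift m φ) n ≫ t) key

/-- A natural numbers object is discrete: if `n = m` holds as an open predicate then `n` and `m`
belong to the same open sets, so they are equal by sobriety. -/
noncomputable def discrete : Discrete N where
  eq := R.eqPred
  eq_iff {Γ} n m := by
    refine ⟨fun h => point_ext fun Δ γ φ => ?_, fun h => ?_⟩
    · have h' : lift (γ ≫ n) (γ ≫ m) ≫ R.eqPred = ⊤ := by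
        simpa [← Category.assoc, tt_eq] using congrArg (fun t => γ ≫ t) h
      simpa [h'] using R.eqPred_inf_app φ (γ ≫ n) (γ ≫ m)
    · rw [h, eqPred_self, tt_eq]

end NatObj

end NatDiscrete

/-! ### Operations on lists -/

section Lists

variable {C : Type u} [Category.{v} C] [CartesianMonoidalCategory C]

namespace ListObj

variable {N L : C} (l : ListObj N L) {Γ Δ X : C}

/-- The empty list in an arbitrary context. -/
abbrev nilAt (Γ : C) : Γ ⟶ L := toUnit Γ ≫ l.nil

lemma lift_nil_recur (f : Γ ⟶ X) (g : (Γ ⊗ (N ⊗ L)) ⊗ X ⟶ X) (γ : Δ ⟶ Γ) :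
    lift γ (l.nilAt Δ) ≫ l.recur f g = γ ≫ f := by
  conv_rhs => rw [← l.recur_nil f g, ← Category.assoc]
  simp

lemma lift_cons_recur (f : Γ ⟶ X) (g : (Γ ⊗ (N ⊗ L)) ⊗ X ⟶ X) (γ : Δ ⟶ Γ) (n : Δ ⟶ N)
    (t : Δ ⟶ L) : lift γ (lift n t ≫ l.cons) ≫ l.recur f g =
      lift (lift γ (lift n t)) (lift γ t ≫ l.recur f g) ≫ g := by
  have := congrArg (fun s => lift γ (lift n t) ≫ s) (l.recur_cons f g)
  simpa [← Category.assoc] using this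

/-- Functions that obey the same recursion over lists are equal. -/
lemma funext {h k : Γ ⊗ L ⟶ X} (g : (Γ ⊗ (N ⊗ L)) ⊗ X ⟶ X)
    (h0 : ∀ (Δ : C) (γ : Δ ⟶ Γ), lift γ (l.nilAt Δ) ≫ h = lift γ (l.nilAt Δ) ≫ k)
    (hh : ∀ (Δ : C) (γ : Δ ⟶ Γ) (n : Δ ⟶ N) (t : Δ ⟶ L),
      lift γ (lift n t ≫ l.cons) ≫ h = lift (lift γ (lift n t)) (lift γ t ≫ h) ≫ g)
    (hk : ∀ (Δ : C) (γ : Δ ⟶ Γ) (n : Δ ⟶ N) (t : Δ ⟶ L),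
      lift γ (lift n t ≫ l.cons) ≫ k = lift (lift γ (lift n t)) (lift γ t ≫ k) ≫ g) :
    h = k := by
  have e {h : Γ ⊗ L ⟶ X} (hh : ∀ (Δ : C) (γ : Δ ⟶ Γ) (n : Δ ⟶ N) (t : Δ ⟶ L),
      lift γ (lift n t ≫ l.cons) ≫ h = lift (lift γ (lift n t)) (lift γ t ≫ h) ≫ g) :
      (Γ ◁ l.cons) ≫ h = lift (𝟙 (Γ ⊗ (N ⊗ L))) ((Γ ◁ snd N L) ≫ h) ≫ g := by
    apply tensor_ext
    intro Δ γ a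
    obtain ⟨n, t, rfl⟩ := exists_eq_lift a
    simpa [← Category.assoc] using hh Δ γ n t
  rw [l.recur_unique _ g h rfl (e hh), l.recur_unique _ g k (h0 Γ (𝟙 Γ)).symm (e hk)]

/-- `funext`, at given generalised elements. -/
lemma funext_apply {h k : Γ ⊗ L ⟶ X} (g : (Γ ⊗ (N ⊗ L)) ⊗ X ⟶ X)
    (h0 : ∀ (Δ : C) (γ : Δ ⟶ Γ), lift γ (l.nilAt Δ) ≫ h = lift γ (l.nilAt Δ) ≫ k)
    (hh : ∀ (Δ : C) (γ : Δ ⟶ Γ) (n : Δ ⟶ N) (t : Δ ⟶ L),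
      lift γ (lift n t ≫ l.cons) ≫ h = lift (lift γ (lift n t)) (lift γ t ≫ h) ≫ g)
    (hk : ∀ (Δ : C) (γ : Δ ⟶ Γ) (n : Δ ⟶ N) (t : Δ ⟶ L),
      lift γ (lift n t ≫ l.cons) ≫ k = lift (lift γ (lift n t)) (lift γ t ≫ k) ≫ g)
    (γ : Δ ⟶ Γ) (t : Δ ⟶ L) : lift γ t ≫ h = lift γ t ≫ k := by
  rw [l.funext g h0 hh hk]

/-- The one-element list. -/
def single : N ⟶ L := lift (𝟙 N) (l.nilAt N) ≫ l.cons

lemma comp_single (n : Δ ⟶ N) : n ≫ l.single = lift n (l.nilAt Δ) ≫ l.cons := by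
  simp [single, ← Category.assoc]

/-- Concatenation `(s, t) ↦ t ++ s`, by recursion on `t`. -/
def append : L ⊗ L ⟶ L :=
  l.recur (𝟙 L) (lift (fst _ L ≫ snd L _ ≫ fst N L) (snd _ L) ≫ l.cons)

@[simp] lemma append_nil (s : Δ ⟶ L) : lift s (l.nilAt Δ) ≫ l.append = s := by
  rw [append, lift_nil_recur, Category.comp_id]

@[simp] lemma append_cons (s t : Δ ⟶ L) (n : Δ ⟶ N) :
    lift s (lift n t ≫ l.cons) ≫ l.append = lift n (lift s t ≫ l.append) ≫ l.cons := by
  simp [append, lift_cons_recur, ← Category.assoc]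

/-- For `a : N` and a list `t`, the list of all `a ⋆ m` with `m ∈ t`. -/
def mapOp (op : N ⊗ N ⟶ N) : N ⊗ L ⟶ L :=
  l.recur (l.nilAt N) (lift (lift (fst _ L ≫ fst N _) (fst _ L ≫ snd N _ ≫ fst N L) ≫ op)
    (snd _ L) ≫ l.cons)

@[simp] lemma mapOp_nil (op : N ⊗ N ⟶ N) (a : Δ ⟶ N) :
    lift a (l.nilAt Δ) ≫ l.mapOp op = l.nilAt Δ := by
  rw [mapOp, lift_nil_recur, ← Category.assoc, comp_toUnit]

@[simp] lemma mapOp_cons (op : N ⊗ N ⟶ N) (a n : Δ ⟶ N) (t : Δ ⟶ L) :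
    lift a (lift n t ≫ l.cons) ≫ l.mapOp op =
      lift (lift a n ≫ op) (lift a t ≫ l.mapOp op) ≫ l.cons := by
  simp [mapOp, lift_cons_recur, ← Category.assoc]

/-- For lists `s` and `t`, the list of all `a ⋆ m` with `a ∈ t` and `m ∈ s`. -/
def prodOp (op : N ⊗ N ⟶ N) : L ⊗ L ⟶ L :=
  l.recur (l.nilAt L) (lift (snd _ L) (lift (fst _ L ≫ snd L _ ≫ fst N L)
    (fst _ L ≫ fst L _) ≫ l.mapOp op) ≫ l.append)

@[simp] lemma prodOp_nil (op : N ⊗ N ⟶ N) (s : Δ ⟶ L) :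
    lift s (l.nilAt Δ) ≫ l.prodOp op = l.nilAt Δ := by
  rw [prodOp, lift_nil_recur, ← Category.assoc, comp_toUnit]

@[simp] lemma prodOp_cons (op : N ⊗ N ⟶ N) (s t : Δ ⟶ L) (n : Δ ⟶ N) :
    lift s (lift n t ≫ l.cons) ≫ l.prodOp op =
      lift (lift s t ≫ l.prodOp op) (lift n s ≫ l.mapOp op) ≫ l.append := by
  simp [prodOp, lift_cons_recur, ← Category.assoc]

end ListObj

end Lists

/-! ### Bounded quantifiers -/

section ListPredicates

variable {C : Type u} [Category.{v} C] [CartesianMonoidalCategory C] [Model C]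

namespace ListObj

variable {N L : C} (l : ListObj N L) {Γ Δ X : C}

@[simp] lemma all_nil (ξ : Δ ⟶ Pow N) : lift ξ (l.nilAt Δ) ≫ l.all = ⊤ := by
  rw [all, lift_nil_recur, comp_tt, tt_eq]

@[simp] lemma all_cons (ξ : Δ ⟶ Pow N) (n : Δ ⟶ N) (t : Δ ⟶ L) :
    lift ξ (lift n t ≫ l.cons) ≫ l.all = app ξ n ⊓ lift ξ t ≫ l.all := by
  simp [all, lift_cons_recur, ← Category.assoc, conj_eq]

/-- `∃ m ∈ l. ξ m`, for `ξ : Σ^N` and `l : L`, on `Σ^N ⊗ L`. -/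
def any : Pow N ⊗ L ⟶ Sig C :=
  l.recur ⊥ (app (fst _ (Sig C) ≫ fst (Pow N) _) (fst _ (Sig C) ≫ snd (Pow N) _ ≫ fst N L) ⊔
    snd _ (Sig C))

@[simp] lemma any_nil (ξ : Δ ⟶ Pow N) : lift ξ (l.nilAt Δ) ≫ l.any = ⊥ := by
  rw [any, lift_nil_recur, comp_bot]

@[simp] lemma any_cons (ξ : Δ ⟶ Pow N) (n : Δ ⟶ N) (t : Δ ⟶ L) :
    lift ξ (lift n t ≫ l.cons) ≫ l.any = app ξ n ⊔ lift ξ t ≫ l.any := by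
  simp [any, lift_cons_recur, ← Category.assoc]

@[simp] lemma all_single (ξ : Δ ⟶ Pow N) (n : Δ ⟶ N) :
    lift ξ (n ≫ l.single) ≫ l.all = app ξ n := by
  rw [comp_single, all_cons, all_nil, inf_top_eq]

@[simp] lemma any_single (ξ : Δ ⟶ Pow N) (n : Δ ⟶ N) :
    lift ξ (n ≫ l.single) ≫ l.any = app ξ n := by
  rw [comp_single, any_cons, any_nil, sup_bot_eq]

@[simp] lemma all_append (ξ : Δ ⟶ Pow N) (s t : Δ ⟶ L) :
    lift ξ (lift s t ≫ l.append) ≫ l.all = lift ξ s ≫ l.all ⊓ lift ξ t ≫ l.all := by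
  have key := l.funext_apply
    (h := lift (fst _ L ≫ fst (Pow N) L) (lift (fst _ L ≫ snd (Pow N) L) (snd _ L) ≫ l.append) ≫
      l.all)
    (k := fst _ L ≫ l.all ⊓ lift (fst _ L ≫ fst (Pow N) L) (snd _ L) ≫ l.all)
    (app (fst _ (Sig C) ≫ fst _ (N ⊗ L) ≫ fst (Pow N) L)
      (fst _ (Sig C) ≫ snd _ (N ⊗ L) ≫ fst N L) ⊓ snd _ (Sig C))
    (fun Δ p => by simp [← Category.assoc])
    (fun Δ p n t => by simp [← Category.assoc])
    (fun Δ p n t => by simp [← Category.assoc, inf_left_comm]) (lift ξ s) t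
  simpa [← Category.assoc] using key

@[simp] lemma any_append (ξ : Δ ⟶ Pow N) (s t : Δ ⟶ L) :
    lift ξ (lift s t ≫ l.append) ≫ l.any = lift ξ s ≫ l.any ⊔ lift ξ t ≫ l.any := by
  have key := l.funext_apply
    (h := lift (fst _ L ≫ fst (Pow N) L) (lift (fst _ L ≫ snd (Pow N) L) (snd _ L) ≫ l.append) ≫
      l.any)
    (k := fst _ L ≫ l.any ⊔ lift (fst _ L ≫ fst (Pow N) L) (snd _ L) ≫ l.any)
    (app (fst _ (Sig C) ≫ fst _ (N ⊗ L) ≫ fst (Pow N) L)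
      (fst _ (Sig C) ≫ snd _ (N ⊗ L) ≫ fst N L) ⊔ snd _ (Sig C))
    (fun Δ p => by simp [← Category.assoc])
    (fun Δ p n t => by simp [← Category.assoc])
    (fun Δ p n t => by simp [← Category.assoc, sup_left_comm]) (lift ξ s) t
  simpa [← Category.assoc] using key

section Product

-- The inequalities below are proved as equations `_ ⊓ _ = _` or `_ ⊔ _ = _`, since the
-- uniqueness of recursion yields equations.
variable (op : N ⊗ N ⟶ N) (ξ : Γ ⟶ Pow N)

/-- Distributivity: `∃ b ∈ t. ξ (a ⋆ b)` is `ξ a ∧ ∃ b ∈ t. ξ b`, if `ξ` takes `⋆` to `∧`. -/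
lemma any_mapOp_inf (h : ∀ (Δ : C) (γ : Δ ⟶ Γ) (a b : Δ ⟶ N),
      app (γ ≫ ξ) (lift a b ≫ op) = app (γ ≫ ξ) a ⊓ app (γ ≫ ξ) b)
    (γ : Δ ⟶ Γ) (a : Δ ⟶ N) (t : Δ ⟶ L) :
    lift (γ ≫ ξ) (lift a t ≫ l.mapOp op) ≫ l.any = app (γ ≫ ξ) a ⊓ lift (γ ≫ ξ) t ≫ l.any := by
  have key := l.funext_apply
    (h := lift ((fst _ L ≫ fst Γ N) ≫ ξ) (lift (fst _ L ≫ snd Γ N) (snd _ L) ≫ l.mapOp op) ≫ l.any)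
    (k := app ((fst _ L ≫ fst Γ N) ≫ ξ) (fst _ L ≫ snd Γ N) ⊓
      lift ((fst _ L ≫ fst Γ N) ≫ ξ) (snd _ L) ≫ l.any)
    (app ((fst _ (Sig C) ≫ fst _ (N ⊗ L) ≫ fst Γ N) ≫ ξ)
      (fst _ (Sig C) ≫ fst _ (N ⊗ L) ≫ snd Γ N) ⊓
      app ((fst _ (Sig C) ≫ fst _ (N ⊗ L) ≫ fst Γ N) ≫ ξ)
      (fst _ (Sig C) ≫ snd _ (N ⊗ L) ≫ fst N L) ⊔ snd _ (Sig C))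
    (fun Δ p => by simp [← Category.assoc])
    (fun Δ p n t => by simp [← Category.assoc, h])
    (fun Δ p n t => by simp [← Category.assoc, inf_sup_left]) (lift γ a) t
  simpa [← Category.assoc] using key

lemma any_prodOp_inf (h : ∀ (Δ : C) (γ : Δ ⟶ Γ) (a b : Δ ⟶ N),
      app (γ ≫ ξ) (lift a b ≫ op) = app (γ ≫ ξ) a ⊓ app (γ ≫ ξ) b) (s t : Γ ⟶ L) :
    lift ξ (lift s t ≫ l.prodOp op) ≫ l.any = lift ξ s ≫ l.any ⊓ lift ξ t ≫ l.any := by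
  have key := l.funext_apply
    (h := lift ((fst _ L ≫ fst Γ L) ≫ ξ) (lift (fst _ L ≫ snd Γ L) (snd _ L) ≫ l.prodOp op) ≫
      l.any)
    (k := lift ((fst _ L ≫ fst Γ L) ≫ ξ) (fst _ L ≫ snd Γ L) ≫ l.any ⊓
      lift ((fst _ L ≫ fst Γ L) ≫ ξ) (snd _ L) ≫ l.any)
    (snd _ (Sig C) ⊔ app ((fst _ (Sig C) ≫ fst _ (N ⊗ L) ≫ fst Γ L) ≫ ξ)
      (fst _ (Sig C) ≫ snd _ (N ⊗ L) ≫ fst N L) ⊓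
      lift ((fst _ (Sig C) ≫ fst _ (N ⊗ L) ≫ fst Γ L) ≫ ξ)
        (fst _ (Sig C) ≫ fst _ (N ⊗ L) ≫ snd Γ L) ≫ l.any)
    (fun Δ p => by simp [← Category.assoc])
    (fun Δ p n t => by simp [← Category.assoc, l.any_mapOp_inf op ξ h])
    (fun Δ p n t => by
      simp only [← Category.assoc, comp_inf, comp_sup, comp_app, comp_lift, lift_fst, lift_snd,
        any_cons]
      rw [inf_sup_left, sup_comm, inf_comm (app _ n)])
    (lift (𝟙 Γ) s) t
  simpa [← Category.assoc] using key

/-- Distributivity: `∀ b ∈ t. ξ (a ⋆ b)` is `ξ a ∨ ∀ b ∈ t. ξ b`, if `ξ` takes `⋆` to `∨`. -/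
lemma all_mapOp_sup (h : ∀ (Δ : C) (γ : Δ ⟶ Γ) (a b : Δ ⟶ N),
      app (γ ≫ ξ) (lift a b ≫ op) = app (γ ≫ ξ) a ⊔ app (γ ≫ ξ) b)
    (γ : Δ ⟶ Γ) (a : Δ ⟶ N) (t : Δ ⟶ L) :
    lift (γ ≫ ξ) (lift a t ≫ l.mapOp op) ≫ l.all = app (γ ≫ ξ) a ⊔ lift (γ ≫ ξ) t ≫ l.all := by
  have key := l.funext_apply
    (h := lift ((fst _ L ≫ fst Γ N) ≫ ξ) (lift (fst _ L ≫ snd Γ N) (snd _ L) ≫ l.mapOp op) ≫ l.all)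
    (k := app ((fst _ L ≫ fst Γ N) ≫ ξ) (fst _ L ≫ snd Γ N) ⊔
      lift ((fst _ L ≫ fst Γ N) ≫ ξ) (snd _ L) ≫ l.all)
    ((app ((fst _ (Sig C) ≫ fst _ (N ⊗ L) ≫ fst Γ N) ≫ ξ)
      (fst _ (Sig C) ≫ fst _ (N ⊗ L) ≫ snd Γ N) ⊔
      app ((fst _ (Sig C) ≫ fst _ (N ⊗ L) ≫ fst Γ N) ≫ ξ)
      (fst _ (Sig C) ≫ snd _ (N ⊗ L) ≫ fst N L)) ⊓ snd _ (Sig C))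
    (fun Δ p => by simp [← Category.assoc])
    (fun Δ p n t => by simp [← Category.assoc, h])
    (fun Δ p n t => by simp [← Category.assoc, sup_inf_left]) (lift γ a) t
  simpa [← Category.assoc] using key

lemma all_prodOp_sup (h : ∀ (Δ : C) (γ : Δ ⟶ Γ) (a b : Δ ⟶ N),
      app (γ ≫ ξ) (lift a b ≫ op) = app (γ ≫ ξ) a ⊔ app (γ ≫ ξ) b) (s t : Γ ⟶ L) :
    lift ξ (lift s t ≫ l.prodOp op) ≫ l.all = lift ξ s ≫ l.all ⊔ lift ξ t ≫ l.all := by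
  have key := l.funext_apply
    (h := lift ((fst _ L ≫ fst Γ L) ≫ ξ) (lift (fst _ L ≫ snd Γ L) (snd _ L) ≫ l.prodOp op) ≫
      l.all)
    (k := lift ((fst _ L ≫ fst Γ L) ≫ ξ) (fst _ L ≫ snd Γ L) ≫ l.all ⊔
      lift ((fst _ L ≫ fst Γ L) ≫ ξ) (snd _ L) ≫ l.all)
    (snd _ (Sig C) ⊓ (app ((fst _ (Sig C) ≫ fst _ (N ⊗ L) ≫ fst Γ L) ≫ ξ)
      (fst _ (Sig C) ≫ snd _ (N ⊗ L) ≫ fst N L) ⊔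
      lift ((fst _ (Sig C) ≫ fst _ (N ⊗ L) ≫ fst Γ L) ≫ ξ)
        (fst _ (Sig C) ≫ fst _ (N ⊗ L) ≫ snd Γ L) ≫ l.all))
    (fun Δ p => by simp [← Category.assoc])
    (fun Δ p n t => by simp [← Category.assoc, l.all_mapOp_sup op ξ h])
    (fun Δ p n t => by
      simp only [← Category.assoc, comp_inf, comp_sup, comp_app, comp_lift, lift_fst, lift_snd,
        all_cons]
      rw [sup_inf_left, inf_comm, sup_comm (app _ n)])
    (lift (𝟙 Γ) s) t
  simpa [← Category.assoc] using key

lemma le_all_mapOp_left (h : ∀ (Δ : C) (γ : Δ ⟶ Γ) (a b : Δ ⟶ N),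
      app (γ ≫ ξ) a ≤ app (γ ≫ ξ) (lift a b ≫ op))
    (γ : Δ ⟶ Γ) (a : Δ ⟶ N) (t : Δ ⟶ L) :
    app (γ ≫ ξ) a ≤ lift (γ ≫ ξ) (lift a t ≫ l.mapOp op) ≫ l.all := by
  have key := l.funext_apply
    (h := app ((fst _ L ≫ fst Γ N) ≫ ξ) (fst _ L ≫ snd Γ N) ⊓
      lift ((fst _ L ≫ fst Γ N) ≫ ξ) (lift (fst _ L ≫ snd Γ N) (snd _ L) ≫ l.mapOp op) ≫ l.all)
    (k := app ((fst _ L ≫ fst Γ N) ≫ ξ) (fst _ L ≫ snd Γ N)) (snd _ (Sig C))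
    (fun Δ p => by simp [← Category.assoc])
    (fun Δ p n t => by
      simp only [← Category.assoc, comp_inf, comp_app, comp_lift, lift_fst, lift_snd, mapOp_cons,
        all_cons]
      rw [← inf_assoc, inf_eq_left.2 (h _ _ _ _)])
    (fun Δ p n t => by simp [← Category.assoc]) (lift γ a) t
  rw [← inf_eq_left]
  simpa [← Category.assoc] using key

lemma le_all_mapOp_right (h : ∀ (Δ : C) (γ : Δ ⟶ Γ) (a b : Δ ⟶ N),
      app (γ ≫ ξ) b ≤ app (γ ≫ ξ) (lift a b ≫ op))
    (γ : Δ ⟶ Γ) (a : Δ ⟶ N) (t : Δ ⟶ L) :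
    lift (γ ≫ ξ) t ≫ l.all ≤ lift (γ ≫ ξ) (lift a t ≫ l.mapOp op) ≫ l.all := by
  have key := l.funext_apply
    (h := lift ((fst _ L ≫ fst Γ N) ≫ ξ) (snd _ L) ≫ l.all ⊓
      lift ((fst _ L ≫ fst Γ N) ≫ ξ) (lift (fst _ L ≫ snd Γ N) (snd _ L) ≫ l.mapOp op) ≫ l.all)
    (k := lift ((fst _ L ≫ fst Γ N) ≫ ξ) (snd _ L) ≫ l.all)
    (app ((fst _ (Sig C) ≫ fst _ (N ⊗ L) ≫ fst Γ N) ≫ ξ)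
      (fst _ (Sig C) ≫ snd _ (N ⊗ L) ≫ fst N L) ⊓ snd _ (Sig C))
    (fun Δ p => by simp [← Category.assoc])
    (fun Δ p n t => by
      simp only [← Category.assoc, comp_inf, comp_app, comp_lift, lift_fst, lift_snd, mapOp_cons,
        all_cons]
      rw [inf_inf_inf_comm, inf_eq_left.2 (h _ _ _ _)])
    (fun Δ p n t => by simp [← Category.assoc]) (lift γ a) t
  rw [← inf_eq_left]
  simpa [← Category.assoc] using key

lemma le_all_prodOp_left (h : ∀ (Δ : C) (γ : Δ ⟶ Γ) (a b : Δ ⟶ N),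
      app (γ ≫ ξ) b ≤ app (γ ≫ ξ) (lift a b ≫ op)) (s t : Γ ⟶ L) :
    lift ξ s ≫ l.all ≤ lift ξ (lift s t ≫ l.prodOp op) ≫ l.all := by
  have key := l.funext_apply
    (h := lift ((fst _ L ≫ fst Γ L) ≫ ξ) (fst _ L ≫ snd Γ L) ≫ l.all ⊓
      lift ((fst _ L ≫ fst Γ L) ≫ ξ) (lift (fst _ L ≫ snd Γ L) (snd _ L) ≫ l.prodOp op) ≫ l.all)
    (k := lift ((fst _ L ≫ fst Γ L) ≫ ξ) (fst _ L ≫ snd Γ L) ≫ l.all) (snd _ (Sig C))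
    (fun Δ p => by simp [← Category.assoc])
    (fun Δ p n t => by
      simp only [← Category.assoc, comp_inf, comp_lift, lift_fst, lift_snd, prodOp_cons,
        all_append]
      rw [inf_left_comm, inf_eq_left.2 (l.le_all_mapOp_right op ξ h _ _ _), inf_comm])
    (fun Δ p n t => by simp [← Category.assoc]) (lift (𝟙 Γ) s) t
  rw [← inf_eq_left]
  simpa [← Category.assoc] using key

lemma le_all_prodOp_right (h : ∀ (Δ : C) (γ : Δ ⟶ Γ) (a b : Δ ⟶ N),
      app (γ ≫ ξ) a ≤ app (γ ≫ ξ) (lift a b ≫ op)) (s t : Γ ⟶ L) :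
    lift ξ t ≫ l.all ≤ lift ξ (lift s t ≫ l.prodOp op) ≫ l.all := by
  have key := l.funext_apply
    (h := lift ((fst _ L ≫ fst Γ L) ≫ ξ) (snd _ L) ≫ l.all ⊓
      lift ((fst _ L ≫ fst Γ L) ≫ ξ) (lift (fst _ L ≫ snd Γ L) (snd _ L) ≫ l.prodOp op) ≫ l.all)
    (k := lift ((fst _ L ≫ fst Γ L) ≫ ξ) (snd _ L) ≫ l.all)
    (app ((fst _ (Sig C) ≫ fst _ (N ⊗ L) ≫ fst Γ L) ≫ ξ)
      (fst _ (Sig C) ≫ snd _ (N ⊗ L) ≫ fst N L) ⊓ snd _ (Sig C))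
    (fun Δ p => by simp [← Category.assoc])
    (fun Δ p n t => by
      simp only [← Category.assoc, comp_inf, comp_app, comp_lift, lift_fst, lift_snd, prodOp_cons,
        all_append, all_cons]
      rw [inf_comm (lift _ (lift _ t ≫ _) ≫ _), inf_inf_inf_comm,
        inf_eq_left.2 (l.le_all_mapOp_left op ξ h _ _ _)])
    (fun Δ p n t => by simp [← Category.assoc]) (lift (𝟙 Γ) s) t
  rw [← inf_eq_left]
  simpa [← Category.assoc] using key

lemma any_mapOp_le_left (h : ∀ (Δ : C) (γ : Δ ⟶ Γ) (a b : Δ ⟶ N),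
      app (γ ≫ ξ) (lift a b ≫ op) ≤ app (γ ≫ ξ) a)
    (γ : Δ ⟶ Γ) (a : Δ ⟶ N) (t : Δ ⟶ L) :
    lift (γ ≫ ξ) (lift a t ≫ l.mapOp op) ≫ l.any ≤ app (γ ≫ ξ) a := by
  have key := l.funext_apply
    (h := app ((fst _ L ≫ fst Γ N) ≫ ξ) (fst _ L ≫ snd Γ N) ⊔
      lift ((fst _ L ≫ fst Γ N) ≫ ξ) (lift (fst _ L ≫ snd Γ N) (snd _ L) ≫ l.mapOp op) ≫ l.any)
    (k := app ((fst _ L ≫ fst Γ N) ≫ ξ) (fst _ L ≫ snd Γ N)) (snd _ (Sig C))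
    (fun Δ p => by simp [← Category.assoc])
    (fun Δ p n t => by
      simp only [← Category.assoc, comp_sup, comp_app, comp_lift, lift_fst, lift_snd, mapOp_cons,
        any_cons]
      rw [← sup_assoc, sup_eq_left.2 (h _ _ _ _)])
    (fun Δ p n t => by simp [← Category.assoc]) (lift γ a) t
  rw [← sup_eq_left]
  simpa [← Category.assoc] using key

lemma any_mapOp_le_right (h : ∀ (Δ : C) (γ : Δ ⟶ Γ) (a b : Δ ⟶ N),
      app (γ ≫ ξ) (lift a b ≫ op) ≤ app (γ ≫ ξ) b)
    (γ : Δ ⟶ Γ) (a : Δ ⟶ N) (t : Δ ⟶ L) :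
    lift (γ ≫ ξ) (lift a t ≫ l.mapOp op) ≫ l.any ≤ lift (γ ≫ ξ) t ≫ l.any := by
  have key := l.funext_apply
    (h := lift ((fst _ L ≫ fst Γ N) ≫ ξ) (snd _ L) ≫ l.any ⊔
      lift ((fst _ L ≫ fst Γ N) ≫ ξ) (lift (fst _ L ≫ snd Γ N) (snd _ L) ≫ l.mapOp op) ≫ l.any)
    (k := lift ((fst _ L ≫ fst Γ N) ≫ ξ) (snd _ L) ≫ l.any)
    (app ((fst _ (Sig C) ≫ fst _ (N ⊗ L) ≫ fst Γ N) ≫ ξ)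
      (fst _ (Sig C) ≫ snd _ (N ⊗ L) ≫ fst N L) ⊔ snd _ (Sig C))
    (fun Δ p => by simp [← Category.assoc])
    (fun Δ p n t => by
      simp only [← Category.assoc, comp_sup, comp_app, comp_lift, lift_fst, lift_snd, mapOp_cons,
        any_cons]
      rw [sup_sup_sup_comm, sup_eq_left.2 (h _ _ _ _)])
    (fun Δ p n t => by simp [← Category.assoc]) (lift γ a) t
  rw [← sup_eq_left]
  simpa [← Category.assoc] using key

lemma any_prodOp_le_left (h : ∀ (Δ : C) (γ : Δ ⟶ Γ) (a b : Δ ⟶ N),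
      app (γ ≫ ξ) (lift a b ≫ op) ≤ app (γ ≫ ξ) b) (s t : Γ ⟶ L) :
    lift ξ (lift s t ≫ l.prodOp op) ≫ l.any ≤ lift ξ s ≫ l.any := by
  have key := l.funext_apply
    (h := lift ((fst _ L ≫ fst Γ L) ≫ ξ) (fst _ L ≫ snd Γ L) ≫ l.any ⊔
      lift ((fst _ L ≫ fst Γ L) ≫ ξ) (lift (fst _ L ≫ snd Γ L) (snd _ L) ≫ l.prodOp op) ≫ l.any)
    (k := lift ((fst _ L ≫ fst Γ L) ≫ ξ) (fst _ L ≫ snd Γ L) ≫ l.any) (snd _ (Sig C))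
    (fun Δ p => by simp [← Category.assoc])
    (fun Δ p n t => by
      simp only [← Category.assoc, comp_sup, comp_lift, lift_fst, lift_snd, prodOp_cons,
        any_append]
      rw [sup_left_comm, sup_eq_left.2 (l.any_mapOp_le_right op ξ h _ _ _), sup_comm])
    (fun Δ p n t => by simp [← Category.assoc]) (lift (𝟙 Γ) s) t
  rw [← sup_eq_left]
  simpa [← Category.assoc] using key

lemma any_prodOp_le_right (h : ∀ (Δ : C) (γ : Δ ⟶ Γ) (a b : Δ ⟶ N),
      app (γ ≫ ξ) (lift a b ≫ op) ≤ app (γ ≫ ξ) a) (s t : Γ ⟶ L) :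
    lift ξ (lift s t ≫ l.prodOp op) ≫ l.any ≤ lift ξ t ≫ l.any := by
  have key := l.funext_apply
    (h := lift ((fst _ L ≫ fst Γ L) ≫ ξ) (snd _ L) ≫ l.any ⊔
      lift ((fst _ L ≫ fst Γ L) ≫ ξ) (lift (fst _ L ≫ snd Γ L) (snd _ L) ≫ l.prodOp op) ≫ l.any)
    (k := lift ((fst _ L ≫ fst Γ L) ≫ ξ) (snd _ L) ≫ l.any)
    (app ((fst _ (Sig C) ≫ fst _ (N ⊗ L) ≫ fst Γ L) ≫ ξ)
      (fst _ (Sig C) ≫ snd _ (N ⊗ L) ≫ fst N L) ⊔ snd _ (Sig C))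
    (fun Δ p => by simp [← Category.assoc])
    (fun Δ p n t => by
      simp only [← Category.assoc, comp_sup, comp_app, comp_lift, lift_fst, lift_snd, prodOp_cons,
        any_append, any_cons]
      rw [sup_comm (lift _ (lift _ t ≫ _) ≫ _), sup_sup_sup_comm,
        sup_eq_left.2 (l.any_mapOp_le_left op ξ h _ _ _)])
    (fun Δ p n t => by simp [← Category.assoc]) (lift (𝟙 Γ) s) t
  rw [← sup_eq_left]
  simpa [← Category.assoc] using key

end Product

section Membership

variable (R : NatObj N) (o : Overt N)

lemma mem_nil (m : Δ ⟶ N) : lift m (l.nilAt Δ) ≫ l.mem R.discrete = ⊥ := by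
  rw [mem, lift_nil_recur, comp_ff, ff_eq]

lemma mem_cons (m n : Δ ⟶ N) (t : Δ ⟶ L) :
    lift m (lift n t ≫ l.cons) ≫ l.mem R.discrete =
      lift n m ≫ R.eqPred ⊔ lift m t ≫ l.mem R.discrete := by
  simp [mem, lift_cons_recur, ← Category.assoc, disj_eq, NatObj.discrete]

lemma mem_append (m : Δ ⟶ N) (s t : Δ ⟶ L) :
    lift m (lift s t ≫ l.append) ≫ l.mem R.discrete =
      lift m s ≫ l.mem R.discrete ⊔ lift m t ≫ l.mem R.discrete := by
  have key := l.funext_apply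
    (h := lift (fst _ L ≫ fst N L) (lift (fst _ L ≫ snd N L) (snd _ L) ≫ l.append) ≫
      l.mem R.discrete)
    (k := fst _ L ≫ l.mem R.discrete ⊔ lift (fst _ L ≫ fst N L) (snd _ L) ≫ l.mem R.discrete)
    (lift (fst _ (Sig C) ≫ snd _ (N ⊗ L) ≫ fst N L)
      (fst _ (Sig C) ≫ fst _ (N ⊗ L) ≫ fst N L) ≫ R.eqPred ⊔ snd _ (Sig C))
    (fun Δ p => by simp [← Category.assoc, mem_nil])
    (fun Δ p n t => by simp [← Category.assoc, mem_cons])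
    (fun Δ p n t => by simp [← Category.assoc, mem_cons, sup_left_comm]) (lift m s) t
  simpa [← Category.assoc] using key

/-- Bounded existential quantification is existential quantification over the members. -/
lemma exists_mem (ξ : Δ ⟶ Pow N) (t : Δ ⟶ L) :
    o.exists (lift (snd Δ N) (fst Δ N ≫ t) ≫ l.mem R.discrete ⊓ app (fst Δ N ≫ ξ) (snd Δ N)) =
      lift ξ t ≫ l.any := by
  have key := l.funext_apply
    (h := o.exists (lift (snd _ N) (fst _ N ≫ snd (Pow N) L) ≫ l.mem R.discrete ⊓
      app (fst _ N ≫ fst (Pow N) L) (snd _ N)))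
    (k := l.any)
    (app (fst _ (Sig C) ≫ fst (Pow N) _) (fst _ (Sig C) ≫ snd (Pow N) _ ≫ fst N L) ⊔
      snd _ (Sig C))
    (fun Δ ξ => by
      rw [any_nil, Overt.comp_exists, eq_bot_iff, Overt.exists_le_iff]
      intro Θ γ n
      simp only [← Category.assoc, comp_inf, comp_app, comp_lift, lift_fst, lift_snd, comp_bot,
        comp_toUnit, mem_nil, bot_inf_eq, le_refl])
    (fun Δ ξ m t => by
      simp only [comp_sup, comp_app, ← Category.assoc, lift_fst, lift_snd, Overt.comp_exists]
      apply le_antisymm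
      · rw [Overt.exists_le_iff]
        intro Θ γ n
        simp only [← Category.assoc, comp_inf, comp_sup, comp_app, comp_lift, lift_fst, lift_snd,
          mem_cons, Overt.comp_exists]
        rw [inf_sup_right, ← R.eqPred_inf_app]
        refine sup_le_sup inf_le_right (le_of_eq_of_le ?_ (o.le_exists _ n))
        simp [← Category.assoc]
      · refine sup_le (le_of_eq_of_le ?_ (o.le_exists _ m)) ?_
        · simp [← Category.assoc, mem_cons, NatObj.eqPred_self]
        · rw [Overt.exists_le_iff]
          intro Θ γ n
          simp only [← Category.assoc, Overt.comp_exists]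
          refine le_trans ?_ (o.le_exists _ n)
          simp only [← Category.assoc, comp_inf, comp_sup, comp_app, comp_lift, lift_fst,
            lift_snd, mem_cons, Category.id_comp, inf_sup_right]
          exact le_sup_right)
    (fun Δ ξ m t => by simp [← Category.assoc]) ξ t
  simpa [← Category.assoc, Overt.comp_exists] using key

end Membership

end ListObj

end ListPredicates

end ASD

/-! ### Constructions with `Σ`-split subobjects -/

namespace ASD

section Split

variable {C : Type u} [Category.{v} C] [CartesianMonoidalCategory C] [Model C]

lemma powMap_comp {X Y Z : C} (i : X ⟶ Y) (j : Y ⟶ Z) :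
    powMap (i ≫ j) = powMap j ≫ powMap i := by
  apply pow_ext
  intro Δ γ x
  simp only [← Category.assoc, app_comp_powMap]

lemma powMap_id (X : C) : powMap (𝟙 X) = 𝟙 (Pow X) := by
  apply pow_ext
  intro Δ γ x
  simp

namespace SigmaSplitSubobject

variable {X Y Z : C}

lemma trans (h : SigmaSplitSubobject X Y) (k : SigmaSplitSubobject Y Z) :
    SigmaSplitSubobject X Z := by
  obtain ⟨i, -, I, hI⟩ := h
  obtain ⟨j, -, J, hJ⟩ := k
  refine ⟨i ≫ j, isSigmaSplit_of_section _ (I ≫ J) ?_⟩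
  rw [powMap_comp, Category.assoc, reassoc_of% hJ, hI]

lemma of_retract (i : X ⟶ Y) (r : Y ⟶ X) (h : i ≫ r = 𝟙 X) : SigmaSplitSubobject X Y := by
  refine ⟨i, isSigmaSplit_of_section _ (powMap r) ?_⟩
  rw [← powMap_comp, h, powMap_id]

/-- The splitting `I` and `Σ^i` make `Σ^X` a retract of `Σ^Y`. -/
lemma pow (h : SigmaSplitSubobject X Y) : SigmaSplitSubobject (Pow X) (Pow Y) := by
  obtain ⟨i, -, I, hI⟩ := h
  exact of_retract I _ hI

lemma prod_right (h : SigmaSplitSubobject X Y) (Z : C) : SigmaSplitSubobject (X ⊗ Z) (Y ⊗ Z) := by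
  obtain ⟨i, -, I, hI⟩ := h
  have hI' {Γ : C} (φ : Γ ⟶ Pow X) (x : Γ ⟶ X) : app (φ ≫ I) (x ≫ i) = app φ x := by
    rw [← app_comp_powMap, Category.assoc, hI, Category.comp_id]
  -- `θ ↦ λ (y, z). I (λ x. θ (x, z)) y`
  refine ⟨lift (fst X Z ≫ i) (snd X Z), isSigmaSplit_of_section _
    (lam (app (lam (app (fst _ X ≫ fst (Pow (X ⊗ Z)) (Y ⊗ Z))
      (lift (snd _ X) (fst _ X ≫ snd _ (Y ⊗ Z) ≫ snd Y Z))) ≫ I)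
      (snd (Pow (X ⊗ Z)) (Y ⊗ Z) ≫ fst Y Z))) ?_⟩
  apply pow_ext
  intro Δ γ p
  obtain ⟨x, z, rfl⟩ := exists_eq_lift p
  simp [← Category.assoc, hI']

lemma prod_left (h : SigmaSplitSubobject X Y) (Z : C) :
    SigmaSplitSubobject (Z ⊗ X) (Z ⊗ Y) :=
  have swap (A B : C) : SigmaSplitSubobject (A ⊗ B) (B ⊗ A) :=
    of_retract (lift (snd A B) (fst A B)) (lift (snd B A) (fst B A)) (by ext <;> simp)
  (swap Z X).trans ((h.prod_right Z).trans (swap Y Z))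

end SigmaSplitSubobject

/-- Exchange of arguments, `x ↦ λ n. β^n x`. -/
def flip {N X : C} (β : N ⟶ Pow X) : X ⟶ Pow N := lam (app (snd X N ≫ β) (fst X N))

@[simp] lemma app_comp_flip {Γ N X : C} (β : N ⟶ Pow X) (x : Γ ⟶ X) (n : Γ ⟶ N) :
    app (x ≫ flip β) n = app (n ≫ β) x := by
  simp [flip, ← Category.assoc]

/-- `θ ↦ λ x. ∃ n. θ n ∧ β^n x`. -/
def combine {N X : C} (o : Overt N) (β : N ⟶ Pow X) : Pow N ⟶ Pow X :=
  lam (o.exists (app (fst _ N ≫ fst (Pow N) X) (snd _ N) ⊓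
    app (snd _ N ≫ β) (fst _ N ≫ snd (Pow N) X)))

@[simp] lemma app_comp_combine {Γ N X : C} (o : Overt N) (β : N ⟶ Pow X) (θ : Γ ⟶ Pow N)
    (x : Γ ⟶ X) : app (θ ≫ combine o β) x =
      o.exists (app (fst Γ N ≫ θ) (snd Γ N) ⊓ app (snd Γ N ≫ β) (fst Γ N ≫ x)) := by
  simp [combine, ← Category.assoc, Overt.comp_exists]

end Split

namespace ListObj

variable {C : Type u} [Category.{v} C] [CartesianMonoidalCategory C] [Model C]
variable {N L : C} (l : ListObj N L) {Γ Δ : C}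

/-- `l ↦ λ ξ. ∀ m ∈ l. ξ m`. -/
def allOf : L ⟶ Pow (Pow N) := lam (lift (snd L (Pow N)) (fst L (Pow N)) ≫ l.all)

/-- `l ↦ λ ξ. ∃ m ∈ l. ξ m`. -/
def anyOf : L ⟶ Pow (Pow N) := lam (lift (snd L (Pow N)) (fst L (Pow N)) ≫ l.any)

@[simp] lemma app_comp_allOf (t : Γ ⟶ L) (ξ : Γ ⟶ Pow N) :
    app (t ≫ l.allOf) ξ = lift ξ t ≫ l.all := by simp [allOf, ← Category.assoc]

@[simp] lemma app_comp_anyOf (t : Γ ⟶ L) (ξ : Γ ⟶ Pow N) :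
    app (t ≫ l.anyOf) ξ = lift ξ t ≫ l.any := by simp [anyOf, ← Category.assoc]

/-- If `ξ n ∧ ζ n ⇒ σ` for all `n`, then `(∀ n ∈ t. ξ n) ∧ (∃ n ∈ t. ζ n) ⇒ σ`. -/
lemma all_inf_any_le (ξ ζ : Γ ⟶ Pow N) (σ : Γ ⟶ Sig C)
    (H : ∀ (Δ : C) (γ : Δ ⟶ Γ) (n : Δ ⟶ N), app (γ ≫ ξ) n ⊓ app (γ ≫ ζ) n ≤ γ ≫ σ) (t : Γ ⟶ L) :
    lift ξ t ≫ l.all ⊓ lift ζ t ≫ l.any ≤ σ := by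
  have key := l.funext_apply
    -- the equation `(all ⊓ any) ⊔ σ = σ`; both sides obey `h (n :: t) = (ξ n ⊔ σ) ⊓ h t`
    (h := (lift (fst Γ L ≫ ξ) (snd Γ L) ≫ l.all ⊓ lift (fst Γ L ≫ ζ) (snd Γ L) ≫ l.any) ⊔
      fst Γ L ≫ σ)
    (k := fst Γ L ≫ σ)
    ((app (fst _ (Sig C) ≫ fst _ (N ⊗ L) ≫ ξ) (fst _ (Sig C) ≫ snd _ (N ⊗ L) ≫ fst N L) ⊔
      fst _ (Sig C) ≫ fst _ (N ⊗ L) ≫ σ) ⊓ snd _ (Sig C))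
    (fun Δ γ => by simp [← Category.assoc])
    (fun Δ γ n t => by
      simp only [← Category.assoc, comp_inf, comp_sup, comp_app, comp_lift, lift_fst, lift_snd,
        all_cons, any_cons]
      have hn := H Δ γ n
      rw [← sup_inf_right]
      refine le_antisymm (sup_le ?_ le_sup_right) (sup_le_sup_right ?_ _)
      · rw [inf_sup_left, inf_assoc _ _ (lift (γ ≫ ζ) t ≫ l.any)]
        exact sup_le (le_sup_of_le_right ((inf_le_inf_right _ inf_le_left).trans hn)) le_sup_left
      · rw [← inf_assoc]
        exact inf_le_inf_left _ le_sup_right)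
    (fun Δ γ n t => by simp [← Category.assoc]) (𝟙 Γ) t
  rw [← sup_eq_right]
  simpa [← Category.assoc] using key

lemma all_eq_top (ξ : Γ ⟶ Pow N)
    (H : ∀ (Δ : C) (γ : Δ ⟶ Γ) (n : Δ ⟶ N), app (γ ≫ ξ) n = ⊤) (t : Γ ⟶ L) :
    lift ξ t ≫ l.all = ⊤ := by
  have key := l.funext_apply (h := lift (fst Γ L ≫ ξ) (snd Γ L) ≫ l.all) (k := ⊤)
    (snd _ (Sig C)) (fun Δ γ => by simp [← Category.assoc])
    (fun Δ γ n t => by simp [← Category.assoc, H]) (fun Δ γ n t => by simp) (𝟙 Γ) t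
  simpa [← Category.assoc] using key

lemma all_eq_inf (χ ξ ζ : Γ ⟶ Pow N)
    (H : ∀ (Δ : C) (γ : Δ ⟶ Γ) (n : Δ ⟶ N), app (γ ≫ χ) n = app (γ ≫ ξ) n ⊓ app (γ ≫ ζ) n)
    (t : Γ ⟶ L) : lift χ t ≫ l.all = lift ξ t ≫ l.all ⊓ lift ζ t ≫ l.all := by
  have key := l.funext_apply (h := lift (fst Γ L ≫ χ) (snd Γ L) ≫ l.all)
    (k := lift (fst Γ L ≫ ξ) (snd Γ L) ≫ l.all ⊓ lift (fst Γ L ≫ ζ) (snd Γ L) ≫ l.all)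
    (app (fst _ (Sig C) ≫ fst _ (N ⊗ L) ≫ χ) (fst _ (Sig C) ≫ snd _ (N ⊗ L) ≫ fst N L) ⊓
      snd _ (Sig C))
    (fun Δ γ => by simp [← Category.assoc])
    (fun Δ γ n t => by simp [← Category.assoc])
    (fun Δ γ n t => by simp [← Category.assoc, H, inf_inf_inf_comm]) (𝟙 Γ) t
  simpa [← Category.assoc] using key

@[simp] lemma app_comp_toPow (d : Discrete N) (t : Γ ⟶ L) (n : Γ ⟶ N) :
    app (t ≫ l.toPow d) n = lift n t ≫ l.mem d := by simp [toPow, ← Category.assoc]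

end ListObj

/-! ### Constructions with bases -/

namespace EffectiveBasis

variable {C : Type u} [Category.{v} C] [CartesianMonoidalCategory C] [Model C]
variable {N L X Y : C}

/-- The Scott principle, as a basis for `Σ^N` indexed by lists: the basic open set given by `t` is
`{ξ | ∀ n ∈ t. ξ n}`, and `A_t` is evaluation at the point `λ n. n ∈ t`. -/
def ofScott (o : Overt N) (d : Discrete N) (l : ListObj N L) (oL : Overt L) (dL : Discrete L) :
    EffectiveBasis L (Pow N) where
  overt := oL
  discrete := dL
  β := l.allOf
  A := l.toPow d ≫ unit (Pow N)
  expansion Φ ξ := by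
    rw [Model.scott o d l oL Φ ξ]
    simp [← Category.assoc]

/-- The restriction of a basis to a `Σ`-split subobject. -/
def pullback (b : EffectiveBasis N Y) (i : X ⟶ Y) (I : Pow X ⟶ Pow Y)
    (h : I ≫ powMap i = 𝟙 (Pow X)) : EffectiveBasis N X where
  overt := b.overt
  discrete := b.discrete
  β := b.β ≫ powMap i
  A := b.A ≫ powMap I
  expansion φ x := by
    conv_lhs => rw [← Category.comp_id φ, ← h, ← Category.assoc, app_comp_powMap, b.expansion]
    simp [← Category.assoc]

section Closure

variable (b : EffectiveBasis N X) (l : ListObj N L) (oL : Overt L) (dL : Discrete L)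

/-- Closure of a basis under finite joins: the list `t` indexes the basic open set
`∃ n ∈ t. β^n` and the dual family `∀ n ∈ t. A_n`. -/
def joinClosure : EffectiveBasis L X where
  overt := oL
  discrete := dL
  β := l.anyOf ≫ powMap (flip b.β)
  A := l.allOf ≫ powMap (flip b.A)
  expansion {Γ} φ x := by
    rw [b.expansion, conj_eq, conj_eq]
    apply le_antisymm
    · rw [Overt.exists_le_iff]
      intro Δ γ n
      rw [Overt.comp_exists]
      refine le_of_eq_of_le ?_ (oL.le_exists _ (n ≫ l.single))
      simp [← Category.assoc]
    · rw [Overt.exists_le_iff]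
      intro Δ γ t
      simp only [← Category.assoc, comp_inf, comp_lift, lift_fst, lift_snd,
        app_comp_powMap, ListObj.app_comp_allOf, ListObj.app_comp_anyOf]
      refine l.all_inf_any_le _ _ _ (fun Θ θ n => ?_) t
      simp only [← Category.assoc, Overt.comp_exists]
      refine le_of_eq_of_le ?_ (b.overt.le_exists _ n)
      simp [← Category.assoc]

/-- The list `t` indexes the basic open set `∀ n ∈ t. β^n` and the dual family
`∃ n ∈ t. A_n`. -/
def meetClosure : EffectiveBasis L X where
  overt := oL
  discrete := dL
  β := l.allOf ≫ powMap (flip b.β)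
  A := l.anyOf ≫ powMap (flip b.A)
  expansion {Γ} φ x := by
    rw [b.expansion, conj_eq, conj_eq]
    apply le_antisymm
    · rw [Overt.exists_le_iff]
      intro Δ γ n
      rw [Overt.comp_exists]
      refine le_of_eq_of_le ?_ (oL.le_exists _ (n ≫ l.single))
      simp [← Category.assoc]
    · rw [Overt.exists_le_iff]
      intro Δ γ t
      simp only [← Category.assoc, comp_inf, comp_lift, lift_fst, lift_snd,
        app_comp_powMap, ListObj.app_comp_allOf, ListObj.app_comp_anyOf]
      rw [inf_comm]
      refine l.all_inf_any_le _ _ _ (fun Θ θ n => ?_) t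
      rw [inf_comm]
      simp only [← Category.assoc, Overt.comp_exists]
      refine le_of_eq_of_le ?_ (b.overt.le_exists _ n)
      simp [← Category.assoc]

variable {Γ : C}

@[simp] lemma app_joinClosure_β (t : Γ ⟶ L) (x : Γ ⟶ X) :
    app (t ≫ (b.joinClosure l oL dL).β) x = lift (x ≫ flip b.β) t ≫ l.any := by
  simp only [joinClosure, ← Category.assoc, app_comp_powMap, ListObj.app_comp_anyOf]

@[simp] lemma app_joinClosure_A (t : Γ ⟶ L) (φ : Γ ⟶ Pow X) :
    app (t ≫ (b.joinClosure l oL dL).A) φ = lift (φ ≫ flip b.A) t ≫ l.all := by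
  simp only [joinClosure, ← Category.assoc, app_comp_powMap, ListObj.app_comp_allOf]

@[simp] lemma app_meetClosure_β (t : Γ ⟶ L) (x : Γ ⟶ X) :
    app (t ≫ (b.meetClosure l oL dL).β) x = lift (x ≫ flip b.β) t ≫ l.all := by
  simp only [meetClosure, ← Category.assoc, app_comp_powMap, ListObj.app_comp_allOf]

@[simp] lemma app_meetClosure_A (t : Γ ⟶ L) (φ : Γ ⟶ Pow X) :
    app (t ≫ (b.meetClosure l oL dL).A) φ = lift (φ ≫ flip b.A) t ≫ l.any := by
  simp only [meetClosure, ← Category.assoc, app_comp_powMap, ListObj.app_comp_anyOf]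

/-- The closure under finite joins of an `∧`-basis is a lattice basis, by distributivity. -/
lemma IsMeetBasis.joinClosure {b : EffectiveBasis N X} (hb : b.IsMeetBasis) :
    (b.joinClosure l oL dL).IsLatticeBasis := by
  obtain ⟨one, star, h1, hβ, hA⟩ := hb
  refine ⟨⟨one ≫ l.single, l.prodOp star, fun x => ?_, fun s t x => ?_, fun s t φ => ?_⟩,
    l.nil, l.append, fun x => ?_, fun φ => ?_, fun s t x => ?_, fun s t φ => ?_⟩
  · simpa [← Category.assoc] using h1 x
  · rw [← Category.assoc, app_joinClosure_β, app_joinClosure_β, app_joinClosure_β]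
    refine l.any_prodOp_inf star _ (fun Δ γ n m => ?_) s t
    have := hβ n m (γ ≫ x)
    simpa [← Category.assoc, conj_eq] using this
  · simp only [imp_iff, ← Category.assoc, app_joinClosure_A]
    constructor
    · refine l.le_all_prodOp_left star _ (fun Δ γ n m => ?_) s t
      have := (hA n m (γ ≫ φ)).2
      simpa [← Category.assoc, imp_iff] using this
    · refine l.le_all_prodOp_right star _ (fun Δ γ n m => ?_) s t
      have := (hA n m (γ ≫ φ)).1
      simpa [← Category.assoc, imp_iff] using this
  · rw [← Category.assoc, app_joinClosure_β, ListObj.any_nil, ff_eq]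
  · rw [← Category.assoc, app_joinClosure_A, ListObj.all_nil, tt_eq]
  · rw [← Category.assoc, app_joinClosure_β, app_joinClosure_β, app_joinClosure_β,
      ListObj.any_append, disj_eq]
  · rw [← Category.assoc, app_joinClosure_A, app_joinClosure_A, app_joinClosure_A,
      ListObj.all_append, conj_eq]

/-- In the closure under finite joins of a prime basis, `A_t φ` is `∀ n ∈ t. φ p^n`. -/
lemma IsPrimeBasis.joinClosure {b : EffectiveBasis N X} (hb : b.IsPrimeBasis) :
    (b.joinClosure l oL dL).IsFilterBasis := by
  obtain ⟨p, hp⟩ := hb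
  refine ⟨fun t => ?_, fun t φ ψ => ?_⟩
  · rw [app_joinClosure_A]
    refine l.all_eq_top _ (fun Δ γ n => ?_) t
    rw [← Category.assoc, app_comp_flip, hp]
    simp [tt_eq]
  · rw [app_joinClosure_A, app_joinClosure_A, app_joinClosure_A]
    refine l.all_eq_inf _ _ _ (fun Δ γ n => ?_) t
    simp only [← Category.assoc, app_comp_flip, hp]
    simp [conj_eq]

end Closure

/-- `φ ↦ λ n. A_n φ` embeds `Σ^X` as a retract of `Σ^N`; this restates the basis expansion. -/
lemma flip_combine (b : EffectiveBasis N X) :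
    flip b.A ≫ combine b.overt b.β = 𝟙 (Pow X) := by
  apply pow_ext
  intro Δ φ x
  rw [Category.comp_id, b.expansion φ x]
  simp [← Category.assoc, conj_eq]

/-- A basis embeds `X` in `Σ^N`, by `x ↦ λ n. β^n x`. -/
lemma sigmaSplit (b : EffectiveBasis N X) : SigmaSplitSubobject X (Pow N) := by
  refine ⟨flip b.β, isSigmaSplit_of_section _ (flip b.A ≫ combine b.overt (unit N)) ?_⟩
  apply pow_ext
  intro Δ φ x
  rw [Category.comp_id, b.expansion φ x]
  simp [← Category.assoc, conj_eq]

end EffectiveBasis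

end ASD

/-! ### Definable and locally compact objects -/

namespace ASD

section Main

variable {C : Type u} [Category.{v} C] [CartesianMonoidalCategory C] [Model C]

namespace EffectiveBasis

variable {N L X Y : C}

lemma IsMeetBasis.pullback {b : EffectiveBasis N Y} (hb : b.IsMeetBasis) (i : X ⟶ Y)
    (I : Pow X ⟶ Pow Y) (h : I ≫ powMap i = 𝟙 (Pow X)) : (b.pullback i I h).IsMeetBasis := by
  obtain ⟨one, star, h1, hβ, hA⟩ := hb
  refine ⟨one, star, fun x => ?_, fun n m x => ?_, fun n m φ => ?_⟩
  · simpa [EffectiveBasis.pullback, ← Category.assoc] using h1 (x ≫ i)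
  · simpa [EffectiveBasis.pullback, ← Category.assoc] using hβ n m (x ≫ i)
  · simpa [EffectiveBasis.pullback, ← Category.assoc] using hA n m (φ ≫ I)

section Scott

variable (o : Overt N) (d : Discrete N) (l : ListObj N L) (oL : Overt L) (dL : Discrete L)

@[simp] lemma app_ofScott_β {Γ : C} (t : Γ ⟶ L) (ξ : Γ ⟶ Pow N) :
    app (t ≫ (ofScott o d l oL dL).β) ξ = lift ξ t ≫ l.all := l.app_comp_allOf t ξ

@[simp] lemma app_ofScott_A {Γ : C} (t : Γ ⟶ L) (Φ : Γ ⟶ Pow (Pow N)) :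
    app (t ≫ (ofScott o d l oL dL).A) Φ = app Φ (t ≫ l.toPow d) := by
  simp only [ofScott, ← Category.assoc, app_comp_unit]

end Scott

end EffectiveBasis

variable (C) in
/-- The basis for `Σ^ℕ` that the Scott principle provides, with lists coded as numbers. -/
noncomputable def scottBasis : EffectiveBasis (Nats C) (Pow (Nats C)) :=
  .ofScott Model.natOvert Model.natObj.discrete Model.natObj.listObj Model.natOvert
    Model.natObj.discrete

lemma scottBasis_isMeetBasis : (scottBasis C).IsMeetBasis := by
  refine ⟨Model.natObj.listObj.nil, Model.natObj.listObj.append, fun ξ => ?_, fun s t ξ => ?_,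
    fun s t Φ => ?_⟩
  · rw [← Category.assoc, scottBasis, EffectiveBasis.app_ofScott_β, ListObj.all_nil, tt_eq]
  · simp only [← Category.assoc, scottBasis, EffectiveBasis.app_ofScott_β, ListObj.all_append,
      conj_eq]
  · simp only [← Category.assoc, scottBasis, EffectiveBasis.app_ofScott_A, imp_iff]
    constructor
    all_goals
      apply app_mono
      intro Δ γ m
      simp only [← Category.assoc, ListObj.app_comp_toPow, comp_lift, ListObj.mem_append,
        le_sup_left, le_sup_right]

namespace SigmaSplitSubobject

/-- By the Scott principle, `Φ : Σ^(Σ^ℕ)` is determined by its values at finite sets, that is, at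
lists, which are coded as numbers. -/
lemma pow_pow_nat : SigmaSplitSubobject (Pow (Pow (Nats C))) (Pow (Nats C)) :=
  of_retract _ _ (scottBasis C).flip_combine

/-- `ℕ` has the basis of singletons: `φ x` is `∃ n. φ n ∧ n = x`. -/
lemma nat : SigmaSplitSubobject (Nats C) (Pow (Nats C)) := by
  let b : EffectiveBasis (Nats C) (Nats C) :=
    { overt := Model.natOvert
      discrete := Model.natObj.discrete
      β := lam Model.natObj.eqPred
      A := unit _
      expansion := fun φ x => by
        rw [conj_eq]
        apply le_antisymm
        · refine le_of_eq_of_le ?_ (Model.natOvert.le_exists _ x)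
          simp [← Category.assoc, NatObj.eqPred_self]
        · rw [Overt.exists_le_iff]
          intro Δ γ n
          simp only [← Category.assoc, comp_inf, comp_app, comp_lift, lift_fst, lift_snd,
            app_comp_unit, app_comp_lam]
          rw [inf_comm, NatObj.eqPred_inf_app]
          exact inf_le_right }
  exact b.sigmaSplit

/-- `Σ^N × Σ^N` is a retract of `Σ^N`: the pair `(ξ, ζ)` is coded by the predicate that is `ξ b`
at `pair (0, b)` and `ζ b` at `pair (a + 1, b)`. -/
lemma pow_prod_pow {N : C} (R : NatObj N) : SigmaSplitSubobject (Pow N ⊗ Pow N) (Pow N) := by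
  let c : ((Pow N ⊗ Pow N) ⊗ N) ⊗ N ⟶ Sig C :=
    R.cases (app (fst (Pow N ⊗ Pow N) N ≫ fst _ _) (snd _ N))
      (app ((fst ((Pow N ⊗ Pow N) ⊗ N) N ≫ fst _ N) ≫ snd _ _) (fst _ N ≫ snd _ N))
  let e : Pow N ⊗ Pow N ⟶ Pow N :=
    lam (lift (lift (fst _ N) ((snd _ N ≫ R.unpair) ≫ snd N N)) ((snd _ N ≫ R.unpair) ≫ fst N N) ≫
      c)
  let point (a : 𝟙_ C ⟶ N) : Pow N ⟶ Pow N :=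
    lam (app (fst (Pow N) N) (lift (toUnit _ ≫ a) (snd (Pow N) N) ≫ R.pair))
  refine of_retract e (lift (point R.zero) (point (R.zero ≫ R.succ))) ?_
  ext
  all_goals
    simp only [comp_lift, lift_fst, lift_snd, Category.id_comp]
    apply pow_ext
    intro Δ γ b
    obtain ⟨ξ, ζ, rfl⟩ := exists_eq_lift γ
    simp [← Category.assoc, e, point, c]

lemma prod {X Y : C} (hX : SigmaSplitSubobject X (Pow (Nats C)))
    (hY : SigmaSplitSubobject Y (Pow (Nats C))) :
    SigmaSplitSubobject (X ⊗ Y) (Pow (Nats C)) :=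
  (hX.prod_right Y).trans ((hY.prod_left _).trans (pow_prod_pow Model.natObj))

end SigmaSplitSubobject

/-- Every definable object is a `Σ`-split subobject of `Σ^ℕ`. -/
lemma Definable.sigmaSplit {X : C} (h : Definable X) : SigmaSplitSubobject X (Pow (Nats C)) := by
  induction h with
  | one => exact .of_retract (lam ⊤) (toUnit _) (toUnit_unique _ _)
  | nat => exact .nat
  | prod _ _ hX hY => exact hX.prod hY
  | pow _ hX => exact hX.pow.trans .pow_pow_nat
  | split i hi _ hY => exact .trans ⟨i, hi⟩ hY

/-- If `N` is a `Σ`-split subobject of `Σ^ℕ` then `Σ^N` is one of `Σ^(Σ^ℕ)`, and so of `Σ^ℕ`. -/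
lemma LocallyCompact.sigmaSplit {X : C} (h : LocallyCompact X) :
    SigmaSplitSubobject X (Pow (Nats C)) := by
  obtain ⟨N, hN, ⟨b⟩⟩ := h
  exact b.sigmaSplit.trans (hN.sigmaSplit.pow.trans .pow_pow_nat)

/-- From a basis `(β, A)` for `X`, a prime `∧`-basis for `Σ^X` whose basic open sets are closed
under finite joins. Let `(β', A')` be the closure of `(β, A)` under finite meets of the `β` and
joins of the `A`. Then `Σ^X` is a retract of `Σ^ℕ` by means of `A'`, and the list `t` indexes the
basic open set `∀ n ∈ t. A'_n` and the point `∃ n ∈ t. β'^n` of `Σ^X`. Joins of basic open sets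
are computed by distributivity from `A'_(m ++ n) = A'_m ∨ A'_n`. -/
lemma exists_prime_basis_pow {X : C} (b₀ : EffectiveBasis (Nats C) X) :
    ∃ b : EffectiveBasis (Nats C) (Pow X), b.IsPrimeBasis ∧ b.IsMeetBasis ∧ b.IsJoinClosed := by
  obtain ⟨l, hl⟩ : ∃ l : ListObj (Nats C) (Nats C), Model.natObj.listObj = l := ⟨_, rfl⟩
  obtain ⟨b, bβ, bA, b0⟩ : ∃ b : EffectiveBasis (Nats C) X,
      (∀ {Γ : C} (s t : Γ ⟶ Nats C) (x : Γ ⟶ X),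
        app ((lift s t ≫ l.append) ≫ b.β) x = app (s ≫ b.β) x ⊓ app (t ≫ b.β) x) ∧
      (∀ {Γ : C} (s t : Γ ⟶ Nats C) (φ : Γ ⟶ Pow X),
        app ((lift s t ≫ l.append) ≫ b.A) φ = app (s ≫ b.A) φ ⊔ app (t ≫ b.A) φ) ∧
      (∀ {Γ : C} (φ : Γ ⟶ Pow X), app (l.nilAt Γ ≫ b.A) φ = ⊥) :=
    ⟨b₀.meetClosure l Model.natOvert Model.natObj.discrete, by simp [-Category.assoc],
      by simp [-Category.assoc], by simp [-Category.assoc]⟩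
  have hI : powMap (combine b.overt b.β) ≫ powMap (flip b.A) = 𝟙 _ := by
    rw [← powMap_comp, b.flip_combine, powMap_id]
  obtain ⟨c, hc, cβ, cA⟩ : ∃ c : EffectiveBasis (Nats C) (Pow X), c.IsMeetBasis ∧
      (∀ {Γ : C} (t : Γ ⟶ Nats C) (φ : Γ ⟶ Pow X),
        app (t ≫ c.β) φ = lift (φ ≫ flip b.A) t ≫ l.all) ∧
      (∀ {Γ : C} (t : Γ ⟶ Nats C) (Φ : Γ ⟶ Pow (Pow X)), app (t ≫ c.A) Φ =
        app Φ (t ≫ l.toPow Model.natObj.discrete ≫ combine b.overt b.β)) := by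
    refine ⟨(scottBasis C).pullback _ _ hI, scottBasis_isMeetBasis.pullback _ _ hI,
      fun t φ => ?_, fun t Φ => ?_⟩
    · simp only [EffectiveBasis.pullback, ← Category.assoc, app_comp_powMap, scottBasis, hl,
        EffectiveBasis.app_ofScott_β]
    · simp only [EffectiveBasis.pullback, ← Category.assoc, app_comp_powMap, scottBasis, hl,
        EffectiveBasis.app_ofScott_A]
  have hp {Γ : C} (t : Γ ⟶ Nats C) (x : Γ ⟶ X) :
      app (t ≫ l.toPow Model.natObj.discrete ≫ combine b.overt b.β) x =
        lift (x ≫ flip b.β) t ≫ l.any := by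
    rw [← l.exists_mem Model.natObj b.overt]
    simp [← Category.assoc]
  refine ⟨c, ⟨_, cA⟩, hc, l.nil ≫ l.single, l.prodOp l.append, fun φ => ?_, fun s t φ => ?_,
    fun s t Φ => ?_⟩
  · rw [← Category.assoc, cβ, ← Category.assoc, l.all_single, app_comp_flip, b0, ff_eq]
  · rw [← Category.assoc, cβ, cβ, cβ]
    exact l.all_prodOp_sup _ _ (fun Δ γ m n => by simp [← Category.assoc, bA]) s t
  · rw [← Category.assoc, cA, cA, cA, imp_iff, imp_iff]
    constructor
    all_goals
      apply app_mono
      intro Δ γ x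
      rw [← Category.assoc γ, hp, ← Category.assoc γ (lift s t), comp_lift, ← Category.assoc γ, hp]
    · exact l.any_prodOp_le_left _ _
        (fun Θ θ m n => by simp [← Category.assoc, bβ]) (γ ≫ s) (γ ≫ t)
    · exact l.any_prodOp_le_right _ _
        (fun Θ θ m n => by simp [← Category.assoc, bβ]) (γ ≫ s) (γ ≫ t)

end Main

end ASD

theorem mainTheorem3 {C : Type u} [Category.{v} C] [CartesianMonoidalCategory C] [ASD.Model C] :
    ∃ (F FF : C) (_ : ASD.ListObj (ASD.Nats C) F) (_ : ASD.ListObj F FF),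
      ∀ X : C, ASD.Definable X ∨ ASD.LocallyCompact X →
        (∃ b : ASD.EffectiveBasis FF X, b.IsLatticeBasis) ∧
        ASD.SigmaSplitSubobject X (ASD.Pow (ASD.Nats C)) ∧
        (∃ b : ASD.EffectiveBasis FF (ASD.Pow X),
          b.IsPrimeBasis ∧ b.IsMeetBasis ∧ b.IsJoinClosed) ∧
        (∃ b : ASD.EffectiveBasis FF (ASD.Pow X), b.IsLatticeBasis ∧ b.IsFilterBasis) := by
  let l : ASD.ListObj (ASD.Nats C) (ASD.Nats C) := ASD.Model.natObj.listObj
  refine ⟨ASD.Nats C, ASD.Nats C, l, l, fun X hX => ?_⟩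
  have hS : ASD.SigmaSplitSubobject X (ASD.Pow (ASD.Nats C)) :=
    hX.elim ASD.Definable.sigmaSplit ASD.LocallyCompact.sigmaSplit
  obtain ⟨i, hi, I, hI⟩ := hS
  let b := (ASD.scottBasis C).pullback i I hI
  have hb : b.IsMeetBasis := ASD.scottBasis_isMeetBasis.pullback i I hI
  obtain ⟨c, hc₁, hc₂, hc₃⟩ := ASD.exists_prime_basis_pow b
  exact ⟨⟨_, hb.joinClosure l ASD.Model.natOvert ASD.Model.natObj.discrete⟩, ⟨i, hi, I, hI⟩,
    ⟨c, hc₁, hc₂, hc₃⟩,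
    ⟨_, hc₂.joinClosure l ASD.Model.natOvert ASD.Model.natObj.discrete,
      hc₁.joinClosure l ASD.Model.natOvert ASD.Model.natObj.discrete⟩⟩
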